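/- Let $\Sigma$ be a finite alphabet containing two distinct symbols $\mathbf 0,\mathbf 1$, let $\circ\notin\Sigma$ be a symbol for the empty cell, put $\Sigma_\circ:=\Sigma\cup\{\circ\}$, and fix a total ordering of $\Sigma_\circ$. A *tape content* is a partial class function $x$ from $\mathrm{Ord}$ to $\Sigma$ (we write $x(\eta)=\circ$ if $x(\eta)$ is undefined), and $\Sigma^{<\mathrm{Ord}}$ is the class of tape contents whose domain is an ordinal. A *transfinite program* is a partial function $p\colon \mathrm{Ord}\times\Sigma_\circ\dashrightarrow\mathrm{Ord}\times\Sigma_\circ\times\{\text{left},\text{stay},\text{right}\}$ whose domain is a set. The *computation* of $p$ on a tape content $x$ is the sequence of snapshots $(x_\gamma,\alpha_\gamma,\beta_\gamma)$ (tape content, state, head position), $\gamma\in\mathrm{Ord}$, given as follows. - $(x_0,\alpha_0,\beta_0)=(x,0,0)$. - If $p(\alpha_\gamma,x_\gamma(\beta_\gamma))$ is undefined, the snapshot at $\gamma+1$ is the snapshot at $\gamma$. If $p(\alpha_\gamma,x_\gamma(\beta_\gamma))=(\delta,\sigma,\mathbf m)$, then $x_{\gamma+1}$ is $x_\gamma$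 with the content of cell $\beta_\gamma$ replaced by $\sigma$, $\alpha_{\gamma+1}=\delta$, and $\beta_{\gamma+1}$ is $\beta_\gamma+1$ for "right", $\beta_\gamma$ for "stay", and for "left" it is the predecessor of $\beta_\gamma$ if $\beta_\gamma$ is a successor and $0$ otherwise. - If $\lambda$ is a limit, then $x_\lambda(\eta)=\liminf_{\xi<\lambda}x_\xi(\eta)$ for every $\eta$, $\alpha_\lambda=\liminf_{\xi<\lambda}\alpha_\xi$, and $\beta_\lambda=\liminf_{\xi\in I}\beta_\xi:=\sup_{\xi\in I}\min_{\zeta\in I,\,\zeta\ge\xi}\beta_\zeta$, where $I=\{\xi<\lambda : \alpha_\xi=\alpha_\lambda\}$ (with $\sup\varnothing=0$). The computation *halts* if $\alpha_\gamma=1$ for some $\gamma$; its *output*, denoted $p(x)$, is then $x_\gamma$ for the least such $\gamma$. If it does not halt, $p(x)$ is undefined. A non-empty class $A\subseteq\Sigma^{<\mathrm{Ord}}$ is *symmetrically semidecidable* if there is a transfinite program $p$ such that, for every $w\in\Sigma^{<\mathrm{Ord}}$, $p(w)$ is the word of length one with entry $\mathbf 0$ if $w\in A$, and $p(w)$ is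 undefined if $w\notin A$. It is *symmetrically computably enumerable* if there is a transfinite program $p$ such that $A$ is the class of all (defined) outputs $p(v)$ for $v\in\Sigma^{\mathrm O}$, where $\Sigma^{\mathrm O}$ is the class of tape contents whose domain is a singleton $\{\alpha\}$, $\alpha\in\mathrm{Ord}$, with value $\mathbf 0$ there. **Proposition.** The following are equivalent: 1. (The symmetry condition $\mathsf{SC}$.) The class $\Sigma^{<\mathrm{Ord}}$ is symmetrically computably enumerable. 2. Every non-empty symmetrically semidecidable class $A\subseteq\Sigma^{<\mathrm{Ord}}$ is symmetrically computably enumerable. -/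

import Mathlib

universe u v

/-! Sets and classes: `Ordinal.{u}` is the class of all ordinals, "set-sized" means `Small.{u}`, and
classes of ordinals, of tape contents, etc. are arbitrary `Set`s of them. -/

noncomputable section

namespace SymMachine

/-- The motion tokens. -/
inductive Motion
  | left
  | stay
  | right

/-- Tape contents: partial functions from the ordinals to the alphabet `S`. The value `none` is the
symbol for an empty cell, so `Option S` is the alphabet extended by the blank. -/
abbrev Tape (S : Type v) := Ordinal.{u} → Option S

/-- A snapshot: tape content, state, position of the head. -/
structure Snapshot (S : Type v) where
  tape : Tape.{u} S
  state : Ordinal.{u}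
  head : Ordinal.{u}

/-- Transfinite programs: partial functions assigning to a state and a read symbol a new state, a
symbol to write and a motion token; the domain is a set. -/
structure Program (S : Type v) where
  toFun : Ordinal.{u} × Option S → Option (Ordinal.{u} × Option S × Motion)
  small_dom : Small.{u} {q : Ordinal.{u} × Option S // (toFun q).isSome}

/-- Head movement. Moving left from a successor is taking the predecessor; moving left from `0` or
from a limit leads to `0`. -/
def move (m : Motion) (β : Ordinal.{u}) : Ordinal.{u} :=
  match m with
  | .left => Ordinal.limitRecOn β 0 (fun γ _ => γ) (fun _ _ _ => 0)
  | .stay => β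
  | .right => β + 1

/-- The inferior limit `sup_{ξ ∈ I} min_{ζ ∈ I, ξ ≤ ζ} f ζ` of the ordinals `f ξ` with `ξ ∈ I`, where
`I` is a class of indices below `l`. -/
def ordLiminf {l : Ordinal.{u}} (I : Set (Set.Iio l)) (f : Set.Iio l → Ordinal.{u}) : Ordinal.{u} :=
  sSup {a | ∃ ξ ∈ I, ∀ ζ ∈ I, ξ ≤ ζ → a ≤ f ζ}

open Classical in
/-- The inferior limit of a sequence of symbols: the greatest symbol that is eventually a lower
bound (such a symbol exists if `0 < l`). -/
def symLiminf {S : Type v} [Fintype S] [LinearOrder (Option S)] {l : Ordinal.{u}}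
    (f : Set.Iio l → Option S) : Option S :=
  let B : Finset (Option S) := Finset.univ.filter fun a => ∃ ξ, ∀ ζ, ξ ≤ ζ → a ≤ f ζ
  if h : B.Nonempty then B.max' h else none

open Classical in
/-- The transition rule for sequences of successor length, applied to the last snapshot. -/
def step {S : Type v} (p : Program.{u} S) (s : Snapshot.{u} S) : Snapshot.{u} S :=
  match p.toFun (s.state, s.tape s.head) with
  | none => s
  | some (δ, σ, m) => ⟨Function.update s.tape s.head σ, δ, move m s.head⟩

/-- The transfinite transition rule for sequences of limit length `l`: inferior limits of the cell
contents and of the states, and of those head positions which occurred at the new state. -/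
def limitSnapshot {S : Type v} [Fintype S] [LinearOrder (Option S)] {l : Ordinal.{u}}
    (s : Set.Iio l → Snapshot.{u} S) : Snapshot.{u} S where
  tape η := symLiminf fun ξ => (s ξ).tape η
  state := ordLiminf Set.univ fun ξ => (s ξ).state
  head := ordLiminf {ξ | (s ξ).state = ordLiminf Set.univ fun ζ => (s ζ).state}
    fun ξ => (s ξ).head

/-- The computation of the program `p` with initial snapshot `s`. -/
def computation {S : Type v} [Fintype S] [LinearOrder (Option S)] (p : Program.{u} S)
    (s : Snapshot.{u} S) (γ : Ordinal.{u}) : Snapshot.{u} S :=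
  Ordinal.limitRecOn γ s (fun _ t => step p t)
    (fun l _ t => limitSnapshot fun ξ : Set.Iio l => t ξ.1 ξ.2)

/-- The times at which the computation of `p` on the tape content `x`, started in state `0` at cell
`0`, is in the halt state `1`. -/
def haltTimes {S : Type v} [Fintype S] [LinearOrder (Option S)] (p : Program.{u} S)
    (x : Tape.{u} S) : Set Ordinal.{u} :=
  {τ | (computation p ⟨x, 0, 0⟩ τ).state = 1}

/-- The transfinite interpretation of `p`: the partial function that sends `x` to the tape content
at the halting time (the least time at which the state is `1`), if there is one. -/
def interp {S : Type v} [Fintype S] [LinearOrder (Option S)] (p : Program.{u} S) :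
    Tape.{u} S →. Tape.{u} S :=
  fun x => ⟨(haltTimes p x).Nonempty, fun _ => (computation p ⟨x, 0, 0⟩ (sInf (haltTimes p x))).tape⟩

/-- The class of words: tape contents whose domain is an ordinal. -/
abbrev Word (S : Type v) := {x : Tape.{u} S // ∃ ξ : Ordinal.{u}, ∀ η, (x η).isSome ↔ η < ξ}

/-- The tape content with the single symbol `o`, in cell `α`; it represents the ordinal `α`. -/
def ordTape {S : Type v} (o : S) (α : Ordinal.{u}) : Tape.{u} S :=
  open Classical in fun η => if η = α then some o else none

/-- The word of length one consisting of the symbol `o`. -/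
def singleWord {S : Type v} (o : S) : Word.{u} S :=
  ⟨ordTape o 0, 1, fun η => by simp [ordTape]⟩

/-- A partial function from words to words is symmetrically computable if it is the restriction to
words of the interpretation of a transfinite program. -/
def IsComputable {S : Type v} [Fintype S] [LinearOrder (Option S)]
    (f : Word.{u} S →. Word.{u} S) : Prop :=
  ∃ p : Program.{u} S, ∀ w : Word.{u} S, (f w).map Subtype.val = interp p w.1

/-- The pseudocharacteristic function of a class of words: value `o` on `A`, undefined elsewhere. -/
def pseudoChar {S : Type v} (o : S) (A : Set (Word.{u} S)) : Word.{u} S →. Word.{u} S :=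
  fun w => ⟨w ∈ A, fun _ => singleWord o⟩

/-- Symmetric semidecidability. -/
def IsSemidecidable {S : Type v} [Fintype S] [LinearOrder (Option S)] (o : S)
    (A : Set (Word.{u} S)) : Prop :=
  IsComputable (pseudoChar o A)

/-- Symmetric computable enumerability: for some transfinite program, `A` is the class of all
outputs on inputs representing ordinals. -/
def IsCE {S : Type v} [Fintype S] [LinearOrder (Option S)] (o : S)
    (A : Set (Word.{u} S)) : Prop :=
  ∃ p : Program.{u} S, Subtype.val '' A = {y | ∃ α : Ordinal.{u}, y ∈ interp p (ordTape o α)}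

/-- The symmetry condition: the class of all words is symmetrically computably enumerable. -/
def SymmetryCondition (S : Type v) [Fintype S] [LinearOrder (Option S)] (o : S) : Prop :=
  IsCE o (Set.univ : Set (Word.{u} S))

end SymMachine

end

/-!
Let `q` enumerate all words and let `p` semidecide `A`. Then `A` consists of the words that `q` puts
out on those inputs `β` for which `p`, run on this word, halts; the difficulty is to run `q` on `β`
again afterwards. Therefore, the enumeration of `A` starts with the input `2 * β`, from which it
makes a copy of `β` on the even cells and another one on the odd cells. The first run takes place on
the even cells, where `p` leaves only a symbol in cell `0`. So the copy of `β` on the odd cells can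
be found and moved to cell `β`, and `q` applied to it. Conversely, the class of all words is
semidecidable.

Machines are simulated by machines that take a fixed finite number `K` of steps for each step. Since
the limits `l` satisfy `K * l = l`, the simulation stays correct at limit times, provided that the
intermediate states have no influence on the inferior limits. Computations can be concatenated if
they use disjoint sets of states, since the head position at a limit time depends only on the
earlier times at which the machine has been in the limit state.
-/

noncomputable section

namespace SymMachine

open Ordinal Order Filter Set Topology

section Liminf

theorem eventually_nhdsLT_iff {l : Ordinal.{u}} (hl : IsSuccLimit l) {P : Ordinal.{u} → Prop} :
    (∀ᶠ ζ in 𝓝[<] l, P ζ) ↔ ∃ ξ < l, ∀ ζ < l, ξ ≤ ζ → P ζ := by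
  rw [Filter.Eventually, mem_nhdsLT_iff_exists_Ioo_subset' hl.bot_lt]
  constructor
  · rintro ⟨ξ, hξ, h⟩
    exact ⟨ξ + 1, hl.add_one_lt hξ, fun ζ hζ hle => h ⟨add_one_le_iff.1 hle, hζ⟩⟩
  · rintro ⟨ξ, hξ, h⟩
    exact ⟨ξ, hξ, fun ζ hζ => h ζ hζ.2 hζ.1.le⟩

theorem exists_Iio_forall_ge_iff {l : Ordinal.{u}} (hl : IsSuccLimit l) {P : Ordinal.{u} → Prop} :
    (∃ ξ : Iio l, ∀ ζ : Iio l, ξ ≤ ζ → P ζ) ↔ ∀ᶠ ζ in 𝓝[<] l, P ζ := by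
  simp [eventually_nhdsLT_iff hl]

theorem nhdsLT_neBot {l : Ordinal.{u}} (hl : IsSuccLimit l) : (𝓝[<] l).NeBot := by
  refine ⟨fun h => ?_⟩
  obtain ⟨ξ, hξ, hf⟩ := (eventually_nhdsLT_iff hl (P := fun _ => False)).1 (by simp [h])
  exact hf ξ hξ le_rfl

theorem eventually_lt_of_isNormal {f : Ordinal.{u} → Ordinal.{u}} (hf : IsNormal f)
    {l b : Ordinal.{u}} (hl : IsSuccLimit l) (hb : b < f l) : ∀ᶠ ζ in 𝓝[<] l, b < f ζ := by
  obtain ⟨ξ, hξ, h⟩ := (hf.lt_iff_exists_lt hl).1 hb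
  exact (eventually_nhdsLT_iff hl).2 ⟨ξ, hξ, fun ζ _ hle => h.trans_le (hf.monotone hle)⟩

theorem le_symLiminf_iff {S : Type v} [Fintype S] [LinearOrder (Option S)] {l : Ordinal.{u}}
    (hl : IsSuccLimit l) {f : Ordinal.{u} → Option S} {a : Option S} :
    a ≤ symLiminf (fun ξ : Iio l => f ξ) ↔ ∀ᶠ ζ in 𝓝[<] l, a ≤ f ζ := by
  classical
  have hex (b : Option S) := exists_Iio_forall_ge_iff hl (P := fun ζ => b ≤ f ζ)
  simp only [symLiminf, hex]
  obtain ⟨b, hb⟩ := Finite.exists_min (id : Option S → Option S)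
  have hB : (Finset.univ.filter fun a => ∀ᶠ ζ in 𝓝[<] l, a ≤ f ζ).Nonempty :=
    ⟨b, by simp only [Finset.mem_filter_univ]; exact .of_forall fun ζ => hb (f ζ)⟩
  rw [dif_pos hB]
  refine ⟨fun h => ?_, fun h => Finset.le_max' _ _ (by simpa using h)⟩
  have hmax := (Finset.mem_filter.1 (Finset.max'_mem _ hB)).2
  exact hmax.mono fun ζ hζ => h.trans hζ

theorem symLiminf_eq_of_eventually {S : Type v} [Fintype S] [LinearOrder (Option S)]
    {l : Ordinal.{u}} (hl : IsSuccLimit l) {f : Ordinal.{u} → Option S} {s : Option S}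
    (h : ∀ᶠ ζ in 𝓝[<] l, f ζ = s) : symLiminf (fun ξ : Iio l => f ξ) = s := by
  have := nhdsLT_neBot hl
  refine eq_of_forall_le_iff fun a => ?_
  rw [le_symLiminf_iff hl, eventually_congr (h.mono fun ζ hζ => by rw [hζ]), eventually_const]

theorem bddAbove_eventual_lowerBounds {l : Ordinal.{u}} (I : Set (Iio l))
    (f : Iio l → Ordinal.{u}) : BddAbove {a | ∃ ξ ∈ I, ∀ ζ ∈ I, ξ ≤ ζ → a ≤ f ζ} := by
  obtain ⟨b, hb⟩ : BddAbove (range f) := bddAbove_of_small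
  exact ⟨b, fun a ⟨ξ, hξ, h⟩ => (h ξ hξ le_rfl).trans (hb ⟨ξ, rfl⟩)⟩

theorem lt_ordLiminf_iff {l : Ordinal.{u}} {I : Set (Iio l)} {f : Iio l → Ordinal.{u}}
    {b : Ordinal.{u}} : b < ordLiminf I f ↔ ∃ ξ ∈ I, ∀ ζ ∈ I, ξ ≤ ζ → b < f ζ := by
  rcases I.eq_empty_or_nonempty with rfl | ⟨ξ₀, hξ₀⟩
  · simp [ordLiminf]
  · rw [ordLiminf, lt_csSup_iff (bddAbove_eventual_lowerBounds I f)
      ⟨0, ξ₀, hξ₀, fun _ _ _ => zero_le⟩]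
    constructor
    · rintro ⟨a, ⟨ξ, hξ, h⟩, hba⟩
      exact ⟨ξ, hξ, fun ζ hζ hle => hba.trans_le (h ζ hζ hle)⟩
    · rintro ⟨ξ, hξ, h⟩
      exact ⟨b + 1, ⟨ξ, hξ, fun ζ hζ hle => add_one_le_iff.2 (h ζ hζ hle)⟩, lt_add_one b⟩

theorem lt_ordLiminf_univ_iff {l : Ordinal.{u}} (hl : IsSuccLimit l)
    {f : Ordinal.{u} → Ordinal.{u}} {b : Ordinal.{u}} :
    b < ordLiminf univ (fun ξ : Iio l => f ξ) ↔ ∀ᶠ ζ in 𝓝[<] l, b < f ζ := by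
  rw [lt_ordLiminf_iff, ← exists_Iio_forall_ge_iff hl]
  simp

theorem ordLiminf_univ_of_isNormal {f : Ordinal.{u} → Ordinal.{u}} (hf : IsNormal f)
    {l : Ordinal.{u}} (hl : IsSuccLimit l) : ordLiminf univ (fun ξ : Iio l => f ξ) = f l := by
  have := nhdsLT_neBot hl
  refine eq_of_forall_lt_iff fun b => ?_
  rw [lt_ordLiminf_univ_iff hl]
  refine ⟨fun h => ?_, eventually_lt_of_isNormal hf hl⟩
  obtain ⟨ζ, hb, hζ⟩ := (h.and eventually_mem_nhdsWithin).exists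
  exact hb.trans (hf.strictMono hζ)

theorem ordLiminf_univ_const {l : Ordinal.{u}} (hl : IsSuccLimit l) (q : Ordinal.{u}) :
    ordLiminf univ (fun _ : Iio l => q) = q := by
  have := nhdsLT_neBot hl
  refine eq_of_forall_lt_iff fun b => ?_
  rw [lt_ordLiminf_univ_iff hl (f := fun _ => q), eventually_const]

theorem ordLiminf_image {l l' : Ordinal.{u}} {g : Iio l → Iio l'} (hg : StrictMono g)
    (I : Set (Iio l)) (f : Iio l' → Ordinal.{u}) : ordLiminf (g '' I) f = ordLiminf I (f ∘ g) := by
  refine eq_of_forall_lt_iff fun b => ?_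
  simp only [lt_ordLiminf_iff, exists_mem_image, forall_mem_image, hg.le_iff_le,
    Function.comp_apply]

theorem ordLiminf_congr {l : Ordinal.{u}} {I : Set (Iio l)} {f g : Iio l → Ordinal.{u}}
    (h : ∀ ξ ∈ I, f ξ = g ξ) : ordLiminf I f = ordLiminf I g := by
  refine eq_of_forall_lt_iff fun b => ?_
  simp +contextual [lt_ordLiminf_iff, h]

theorem ordLiminf_comp_of_isNormal {l : Ordinal.{u}} {I : Set (Iio l)}
    {f : Iio l → Ordinal.{u}} {g : Ordinal.{u} → Ordinal.{u}} (hg : IsNormal g)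
    (h0 : g 0 = 0 ∨ I.Nonempty) : ordLiminf I (fun ξ => g (f ξ)) = g (ordLiminf I f) := by
  rcases I.eq_empty_or_nonempty with rfl | hI
  · simpa [ordLiminf, eq_comm] using h0
  have hne : {a | ∃ ξ ∈ I, ∀ ζ ∈ I, ξ ≤ ζ → a ≤ f ζ}.Nonempty :=
    let ⟨ξ, hξ⟩ := hI; ⟨0, ξ, hξ, fun _ _ _ => zero_le⟩
  have hbdd := bddAbove_eventual_lowerBounds I f
  refine eq_of_forall_lt_iff fun b => ?_
  rw [lt_ordLiminf_iff, ordLiminf, hg.map_sSup hne hbdd,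
    lt_csSup_iff (hg.monotone.map_bddAbove hbdd) (hne.image g), exists_mem_image]
  constructor
  · rintro ⟨ξ, hξ, h⟩
    obtain ⟨ζ, ⟨hζ, hle⟩, hmin⟩ :=
      exists_minimalFor_of_wellFoundedLT (fun ζ => ζ ∈ I ∧ ξ ≤ ζ) f ⟨ξ, hξ, le_rfl⟩
    exact ⟨f ζ, ⟨ξ, hξ, fun z hz hle => le_of_not_gt fun hlt => hlt.not_ge (hmin ⟨hz, hle⟩ hlt.le)⟩,
      h ζ hζ hle⟩
  · rintro ⟨a, ⟨ξ, hξ, h⟩, hb⟩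
    exact ⟨ξ, hξ, fun ζ hζ hle => hb.trans_le (hg.monotone (h ζ hζ hle))⟩

end Liminf

attribute [ext] Snapshot

section Step

variable {S : Type v} {p : Program.{u} S} {X : Tape.{u} S} {q h δ : Ordinal.{u}} {a σ : Option S}
  {m : Motion}

theorem step_write (ha : X h = a) (hp : p.toFun (q, a) = some (δ, σ, m)) :
    step p ⟨X, q, h⟩ = ⟨Function.update X h σ, δ, move m h⟩ := by
  simp only [step, ha, hp]

theorem step_keep (ha : X h = a) (hp : p.toFun (q, a) = some (δ, a, m)) :
    step p ⟨X, q, h⟩ = ⟨X, δ, move m h⟩ := by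
  rw [step_write ha hp, ← ha, Function.update_eq_self]

end Step

section Computation

variable {S : Type v} [Fintype S] [LinearOrder (Option S)]

theorem computation_zero (p : Program.{u} S) (s : Snapshot.{u} S) : computation p s 0 = s := by
  simp [computation]

theorem computation_add_one (p : Program.{u} S) (s : Snapshot.{u} S) (γ : Ordinal.{u}) :
    computation p s (γ + 1) = step p (computation p s γ) := by
  simp [computation, limitRecOn_add_one]

theorem computation_limit (p : Program.{u} S) (s : Snapshot.{u} S) {l : Ordinal.{u}}
    (hl : IsSuccLimit l) :
    computation p s l = limitSnapshot fun ξ : Iio l => computation p s ξ := by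
  simp [computation, limitRecOn_limit, hl]

theorem computation_add_nat (p : Program.{u} S) (s : Snapshot.{u} S) (γ : Ordinal.{u}) (n : ℕ) :
    computation p s (γ + n) = (step p)^[n] (computation p s γ) := by
  induction n with
  | zero => simp
  | succ n ih =>
    rw [Nat.cast_succ, ← add_assoc, computation_add_one, ih, Function.iterate_succ_apply']

/-- The re-encoding of a snapshot by functions on tape contents, states and head positions. -/
def Snapshot.map {S : Type v} (E : Tape.{u} S → Tape.{u} S) (σ g : Ordinal.{u} → Ordinal.{u})
    (s : Snapshot.{u} S) : Snapshot.{u} S :=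
  ⟨E s.tape, σ s.state, g s.head⟩

/-- A transformation of tape contents is cellwise if each cell of the result either is a copy of a
fixed cell of the argument or has a fixed content. -/
def IsCellwise {S : Type v} (E : Tape.{u} S → Tape.{u} S) : Prop :=
  ∀ c, (∃ c', ∀ X, E X c = X c') ∨ ∃ a, ∀ X, E X c = a

theorem limitSnapshot_map {E : Tape.{u} S → Tape.{u} S} {σ g : Ordinal.{u} → Ordinal.{u}}
    (hE : IsCellwise E) (hσ : IsNormal σ) (hg : IsNormal g) (hg0 : g 0 = 0) {l : Ordinal.{u}}
    (hl : IsSuccLimit l) (s : Ordinal.{u} → Snapshot.{u} S) :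
    limitSnapshot (fun ξ : Iio l => (s ξ).map E σ g) =
      (limitSnapshot fun ξ : Iio l => s ξ).map E σ g := by
  have hstate : ordLiminf univ (fun ξ : Iio l => σ (s ξ).state) =
      σ (ordLiminf univ fun ξ : Iio l => (s ξ).state) :=
    ordLiminf_comp_of_isNormal hσ (.inr ⟨⟨0, hl.bot_lt⟩, trivial⟩)
  refine Snapshot.ext (funext fun c => ?_) hstate ?_
  · change symLiminf (fun ξ : Iio l => E (s ξ).tape c) = E _ c
    rcases hE c with ⟨c', h⟩ | ⟨a, h⟩
    · simp only [h, limitSnapshot]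
    · rw [h]
      exact symLiminf_eq_of_eventually hl (f := fun ξ => E (s ξ).tape c) (.of_forall fun ξ => h _)
  · change ordLiminf {ξ : Iio l | σ (s ξ).state = ordLiminf univ fun ζ : Iio l => σ (s ζ).state}
      (fun ξ => g (s ξ).head) = _
    simp only [hstate, hσ.strictMono.injective.eq_iff]
    exact ordLiminf_comp_of_isNormal hg (.inl hg0)

theorem limitSnapshot_of_const_state {Y : Ordinal.{u} → Tape.{u} S} {q : Ordinal.{u}}
    {f : Ordinal.{u} → Ordinal.{u}} (hf : IsNormal f) {l : Ordinal.{u}} (hl : IsSuccLimit l)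
    (hY : ∀ c, ∀ᶠ ξ in 𝓝[<] l, Y ξ c = Y l c) :
    limitSnapshot (fun ξ : Iio l => ⟨Y ξ, q, f ξ⟩) = ⟨Y l, q, f l⟩ := by
  refine Snapshot.ext (funext fun c => symLiminf_eq_of_eventually hl (hY c))
    (ordLiminf_univ_const hl q) ?_
  simp only [limitSnapshot, ordLiminf_univ_const hl, ← ordLiminf_univ_of_isNormal hf hl]
  rfl

/-- Moving through ever new states, the head returns to cell `0`, since no earlier head position
counts towards the inferior limit. -/
theorem limitSnapshot_of_isNormal_state (X : Tape.{u} S) {σ : Ordinal.{u} → Ordinal.{u}}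
    (hσ : IsNormal σ) (h : Ordinal.{u} → Ordinal.{u}) {l : Ordinal.{u}} (hl : IsSuccLimit l) :
    limitSnapshot (fun ξ : Iio l => ⟨X, σ ξ, h ξ⟩) = ⟨X, σ l, 0⟩ := by
  refine Snapshot.ext
    (funext fun c => symLiminf_eq_of_eventually hl (f := fun _ => X c) (.of_forall fun _ => rfl))
    (ordLiminf_univ_of_isNormal hσ hl) ?_
  have hnew : {ξ : Iio l | σ ξ = σ l} = ∅ :=
    eq_empty_of_forall_notMem fun ξ hξ => (hσ.strictMono ξ.2).ne hξ
  simp only [limitSnapshot, ordLiminf_univ_of_isNormal hσ hl, hnew]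
  simp [ordLiminf]

end Computation

section Subsampling

variable {e : Ordinal.{u} → Ordinal.{u}} {l : Ordinal.{u}}

theorem exists_le_lt_map_add_one (he : IsNormal e) {t : Ordinal.{u}} (ht0 : e 0 ≤ t)
    (ht : t < e l) : ∃ η < l, e η ≤ t ∧ t < e (η + 1) := by
  obtain ⟨η, hle, hlt⟩ := he.exists_map_le_lt_map_succ ht0
  exact ⟨η, he.strictMono.lt_iff_lt.1 (hle.trans_lt ht), hle, hlt⟩

theorem eventually_map_iff (he : IsNormal e) (hl : IsSuccLimit l) {α : Type*} [Preorder α]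
    {F G : Ordinal.{u} → α} (hG : ∀ η < l, F (e η) = G η)
    (hF : ∀ η < l, ∀ t, e η ≤ t → t < e (η + 1) → G η ≤ F t ∨ G (η + 1) ≤ F t)
    {U : Set α} (hU : IsUpperSet U) :
    (∀ᶠ t in 𝓝[<] (e l), F t ∈ U) ↔ ∀ᶠ η in 𝓝[<] l, G η ∈ U := by
  rw [eventually_nhdsLT_iff hl, eventually_nhdsLT_iff (he.map_isSuccLimit hl)]
  constructor
  · rintro ⟨t, ht, h⟩
    obtain ⟨ξ, hξ, htξ⟩ := (he.lt_iff_exists_lt hl).1 ht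
    refine ⟨ξ, hξ, fun η hη hle => ?_⟩
    rw [← hG η hη]
    exact h _ (he.strictMono hη) (htξ.le.trans (he.monotone hle))
  · rintro ⟨ξ, hξ, h⟩
    refine ⟨e ξ, he.strictMono hξ, fun t ht hle => ?_⟩
    obtain ⟨η, hη, hηt, htη⟩ :=
      exists_le_lt_map_add_one he ((he.monotone (zero_le (a := ξ))).trans hle) ht
    have hξη : ξ ≤ η := lt_add_one_iff.1 (he.strictMono.lt_iff_lt.1 (hle.trans_lt htη))
    exact (hF η hη t hηt htη).elim (fun h' => hU h' (h η hη hξη)) fun h' =>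
      hU h' (h _ (hl.add_one_lt hη) (hξη.trans (le_add_of_nonneg_right zero_le)))

variable {S : Type v} [Fintype S] [LinearOrder (Option S)]

/-- The limit rule may be evaluated at the times `e η` only, if the snapshots in between do not
change the inferior limits. -/
theorem limitSnapshot_comp_of_isNormal (he : IsNormal e) (hl : IsSuccLimit l)
    {C hub : Ordinal.{u} → Snapshot.{u} S} (hhub : ∀ η < l, C (e η) = hub η)
    (htape : ∀ η < l, ∀ t, e η ≤ t → t < e (η + 1) → ∀ c,
      (C t).tape c = (hub η).tape c ∨ (C t).tape c = (hub (η + 1)).tape c)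
    (hstate : ∀ η < l, ∀ t, e η ≤ t → t < e (η + 1) →
      (hub η).state ≤ (C t).state ∨ (hub (η + 1)).state ≤ (C t).state)
    (hmid : ∀ t < e l, (C t).state = (limitSnapshot fun ξ : Iio l => hub ξ).state →
      ∃ η, e η = t) :
    limitSnapshot (fun t : Iio (e l) => C t) = limitSnapshot fun ξ : Iio l => hub ξ := by
  have hel := he.map_isSuccLimit hl
  have hs : (limitSnapshot fun t : Iio (e l) => C t).state =
      (limitSnapshot fun ξ : Iio l => hub ξ).state := by
    refine eq_of_forall_lt_iff fun b => ?_
    simp only [limitSnapshot]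
    rw [lt_ordLiminf_univ_iff hel (f := fun t => (C t).state),
      lt_ordLiminf_univ_iff hl (f := fun η => (hub η).state)]
    exact eventually_map_iff he hl (fun η hη => by rw [hhub η hη]) hstate (isUpperSet_Ioi b)
  let g (η : Iio l) : Iio (e l) := ⟨e η, he.strictMono η.2⟩
  have hg : StrictMono g := fun _ _ h => he.strictMono h
  have hI : {t : Iio (e l) | (C t).state = (limitSnapshot fun ξ : Iio l => hub ξ).state} =
      g '' {η | (hub η).state = (limitSnapshot fun ξ : Iio l => hub ξ).state} := by
    ext ⟨t, ht⟩
    constructor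
    · intro htL
      obtain ⟨η, rfl⟩ := hmid t ht htL
      have hη : η < l := he.strictMono.lt_iff_lt.1 ht
      exact ⟨⟨η, hη⟩, (congrArg Snapshot.state (hhub η hη)).symm.trans htL, rfl⟩
    · rintro ⟨η, hη, hηt⟩
      rw [← hηt]
      exact (congrArg Snapshot.state (hhub η η.2)).trans hη
  refine Snapshot.ext (funext fun c => eq_of_forall_le_iff fun a => ?_) hs ?_
  · simp only [limitSnapshot]
    rw [le_symLiminf_iff hel (f := fun t => (C t).tape c),
      le_symLiminf_iff hl (f := fun η => (hub η).tape c)]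
    exact eventually_map_iff he hl (fun η hη => by rw [hhub η hη])
      (fun η hη t h h' => (htape η hη t h h' c).imp Eq.ge Eq.ge) (isUpperSet_Ici a)
  · change ordLiminf {t : Iio (e l) | (C t).state = (limitSnapshot fun t : Iio (e l) => C t).state}
      (fun t => (C t).head) = _
    rw [hs, hI, ordLiminf_image hg]
    exact ordLiminf_congr fun ξ _ => congrArg Snapshot.head (hhub ξ ξ.2)

end Subsampling

section Reaches

variable {S : Type v} [Fintype S] [LinearOrder (Option S)] {p : Program.{u} S}
  {s s' s'' : Snapshot.{u} S} {B B' : Set Ordinal.{u}}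

/-- A computation may be restarted at time `T` if the states assumed before `T` do not recur: the
limit rule for the head looks back at all earlier snapshots of the limit state. -/
theorem computation_add {T N : Ordinal.{u}}
    (hnew : ∀ t < T, ∀ t' ≤ N,
      (computation p s t).state ≠ (computation p (computation p s T) t').state) :
    ∀ t' ≤ N, computation p s (T + t') = computation p (computation p s T) t' := by
  intro t'
  induction t' using limitRecOn with
  | zero => simp [computation_zero]
  | add_one t' ih =>
    intro h
    rw [← add_assoc, computation_add_one, computation_add_one,
      ih ((add_one_le_iff.1 h).le)]
  | limit l hl ih =>
    intro hlN
    have hT := isNormal_add_right T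
    have ih' (η) (hη : η < l) := ih η hη (hη.le.trans hlN)
    have eq_add {η t : Ordinal.{u}} (h : T + η ≤ t) (h' : t < T + (η + 1)) : t = T + η :=
      (lt_add_one_iff.1 (by rwa [← add_assoc] at h')).antisymm h
    rw [computation_limit p s (hT.map_isSuccLimit hl), computation_limit _ _ hl]
    refine limitSnapshot_comp_of_isNormal hT hl ih' (fun η hη t h h' c => ?_)
      (fun η hη t h h' => ?_) fun t _ htL => ?_
    · rw [eq_add h h', ih' η hη]
      exact .inl rfl
    · rw [eq_add h h', ih' η hη]
      exact .inl le_rfl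
    · rw [← computation_limit _ _ hl] at htL
      exact ⟨t - T, Ordinal.add_sub_cancel_of_le <| le_of_not_gt fun htT => hnew t htT l hlN htL⟩

/-- The computation of `p` starting with `s` arrives at `s'`, through states in `B` only; the state
of `s'` itself need not be in `B`. -/
def Reaches (p : Program.{u} S) (B : Set Ordinal.{u}) (s s' : Snapshot.{u} S) : Prop :=
  ∃ T, computation p s T = s' ∧ ∀ t < T, (computation p s t).state ∈ B

/-- The computation of `p` starting with `s` always stays in states in `B`. -/
def RunsForever (p : Program.{u} S) (B : Set Ordinal.{u}) (s : Snapshot.{u} S) : Prop :=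
  ∀ t, (computation p s t).state ∈ B

theorem Reaches.refl (p : Program.{u} S) (B : Set Ordinal.{u}) (s : Snapshot.{u} S) :
    Reaches p B s s :=
  ⟨0, computation_zero p s, fun _ h => (not_lt_zero h).elim⟩

theorem Reaches.mono (h : Reaches p B s s') (hB : B ⊆ B') : Reaches p B' s s' :=
  let ⟨T, hT, hT'⟩ := h
  ⟨T, hT, fun t ht => hB (hT' t ht)⟩

theorem Reaches.step (h : Reaches p B s s') (hs' : s'.state ∈ B) (hs : step p s' = s'') :
    Reaches p B s s'' := by
  obtain ⟨T, rfl, hT⟩ := h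
  refine ⟨T + 1, by rw [computation_add_one, hs], fun t ht => ?_⟩
  rcases (lt_add_one_iff.1 ht).lt_or_eq with ht | rfl
  · exact hT t ht
  · exact hs'

theorem Reaches.steps {f : ℕ → Snapshot.{u} S} {n : ℕ} (h : Reaches p B s (f 0))
    (hB : ∀ j < n, (f j).state ∈ B) (hf : ∀ j < n, SymMachine.step p (f j) = f (j + 1)) :
    Reaches p B s (f n) := by
  induction n with
  | zero => exact h
  | succ n ih =>
    exact (ih (fun j hj => hB j (by omega)) fun j hj => hf j (by omega)).step
      (hB n n.lt_succ_self) (hf n n.lt_succ_self)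

theorem Reaches.trans (h : Reaches p B s s') (h' : Reaches p B' s' s'') (hB : Disjoint B B')
    (hs'' : s''.state ∉ B) : Reaches p (B ∪ B') s s'' := by
  obtain ⟨T, rfl, hT⟩ := h
  obtain ⟨T', rfl, hT'⟩ := h'
  have hadd := computation_add (p := p) (s := s) (T := T) (N := T') fun t ht t' ht' heq => by
    rcases ht'.lt_or_eq with ht' | rfl
    · exact hB.notMem_of_mem_left (hT t ht) (heq ▸ hT' t' ht')
    · exact hs'' (heq ▸ hT t ht)
  refine ⟨T + T', hadd T' le_rfl, fun t ht => ?_⟩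
  rcases lt_or_ge t T with htT | htT
  · exact .inl (hT t htT)
  · obtain ⟨t', rfl⟩ := le_iff_exists_add.1 htT
    have ht' : t' < T' := (add_lt_add_iff_left T).1 ht
    rw [hadd t' ht'.le]
    exact .inr (hT' t' ht')

theorem Reaches.runsForever (h : Reaches p B s s') (h' : RunsForever p B' s')
    (hB : Disjoint B B') : RunsForever p (B ∪ B') s := by
  obtain ⟨T, rfl, hT⟩ := h
  intro t
  rcases lt_or_ge t T with htT | htT
  · exact .inl (hT t htT)
  · obtain ⟨t', rfl⟩ := le_iff_exists_add.1 htT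
    rw [computation_add (N := t') (fun t ht t'' _ heq =>
      hB.notMem_of_mem_left (hT t ht) (heq ▸ h' t'')) t' le_rfl]
    exact .inr (h' t')

theorem Reaches.interp_eq_some {x y : Tape.{u} S} {h : Ordinal.{u}}
    (hr : Reaches p B ⟨x, 0, 0⟩ ⟨y, 1, h⟩) (hB : 1 ∉ B) : interp p x = Part.some y := by
  obtain ⟨T, hT, hT'⟩ := hr
  have hhalt : T ∈ haltTimes p x := by simp [haltTimes, hT]
  have hleast : sInf (haltTimes p x) = T :=
    (csInf_le' hhalt).antisymm <| le_csInf ⟨T, hhalt⟩ fun t ht => le_of_not_gt fun hlt =>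
      hB (ht ▸ hT' t hlt)
  refine Part.ext' ⟨fun _ => trivial, fun _ => ⟨T, hhalt⟩⟩ fun _ _ => ?_
  simp [interp, hleast, hT]

theorem RunsForever.interp_eq_none {x : Tape.{u} S} (hr : RunsForever p B ⟨x, 0, 0⟩)
    (hB : 1 ∉ B) : interp p x = Part.none :=
  Part.eq_none_iff'.2 fun ⟨t, ht⟩ => hB (ht ▸ hr t)

end Reaches

section Itinerary

variable {S : Type v} {r : Program.{u} S} {K : ℕ} {M B : Set Ordinal.{u}}
  {s s' s'' : Snapshot.{u} S} {N : Ordinal.{u}} {hub : Ordinal.{u} → Snapshot.{u} S}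

/-- The program `r` leads from `s` to `s'` in `K` steps. Meanwhile, each cell has its first or its
last content, the state is not below both the first and the last one, and it is in `M` strictly
between these. -/
structure Traverses (r : Program.{u} S) (K : ℕ) (M : Set Ordinal.{u}) (s s' : Snapshot.{u} S) :
    Prop where
  iterate_step : (step r)^[K] s = s'
  tape : ∀ j < K, ∀ c, ((step r)^[j] s).tape c = s.tape c ∨ ((step r)^[j] s).tape c = s'.tape c
  state : ∀ j < K, s.state ≤ ((step r)^[j] s).state ∨ s'.state ≤ ((step r)^[j] s).state
  mem : ∀ j < K, 0 < j → ((step r)^[j] s).state ∈ M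

theorem Traverses.one (h : step r s = s') : Traverses r 1 ∅ s s' where
  iterate_step := h
  tape j hj c := by simp [Nat.lt_one_iff.1 hj]
  state j hj := by simp [Nat.lt_one_iff.1 hj]
  mem j hj hj' := by omega

theorem Traverses.two (h : step r s = s') (h' : step r s' = s'')
    (htape : ∀ c, s'.tape c = s.tape c ∨ s'.tape c = s''.tape c)
    (hstate : s.state ≤ s'.state ∨ s''.state ≤ s'.state) (hM : s'.state ∈ M) :
    Traverses r 2 M s s'' where
  iterate_step := by simp [h, h']
  tape j hj c := by interval_cases j <;> simp [h, htape]
  state j hj := by interval_cases j <;> simp [h, hstate]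
  mem j hj hj' := by
    obtain rfl : j = 1 := by omega
    simpa [h] using hM

variable [Fintype S] [LinearOrder (Option S)]

/-- The snapshots `hub η`, `η ≤ N`, follow each other as in a computation of `r`, except that it
takes `K` steps from one to the next. -/
structure IsItinerary (r : Program.{u} S) (K : ℕ) (M : Set Ordinal.{u}) (N : Ordinal.{u})
    (hub : Ordinal.{u} → Snapshot.{u} S) : Prop where
  traverses : ∀ η < N, Traverses r K M (hub η) (hub (η + 1))
  limit : ∀ l ≤ N, IsSuccLimit l → limitSnapshot (fun ξ : Iio l => hub ξ) = hub l
  notMem : ∀ η ≤ N, (hub η).state ∉ M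

theorem isNormal_natCast_mul (hK : 0 < K) : IsNormal fun η : Ordinal.{u} => K * η :=
  isNormal_mul_right (by exact_mod_cast hK)

theorem exists_eq_natCast_mul_add {t η : Ordinal.{u}} (h : K * η ≤ t) (h' : t < K * (η + 1)) :
    ∃ j < K, t = K * η + (j : ℕ) := by
  obtain ⟨i, rfl⟩ := le_iff_exists_add.1 h
  rw [mul_add_one, add_lt_add_iff_left] at h'
  obtain ⟨j, rfl⟩ := lt_omega0.1 (h'.trans (natCast_lt_omega0 K))
  exact ⟨j, by exact_mod_cast h', rfl⟩

theorem IsItinerary.computation_mul (h : IsItinerary r K M N hub) (hK : 0 < K) :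
    ∀ η ≤ N, computation r (hub 0) (K * η) = hub η := by
  intro η
  induction η using limitRecOn with
  | zero => simp [computation_zero]
  | add_one η ih =>
    intro hη
    have hη' : η < N := add_one_le_iff.1 hη
    rw [mul_add_one, computation_add_nat, ih hη'.le, (h.traverses η hη').iterate_step]
  | limit l hl ih =>
    intro hlN
    have hKn := isNormal_natCast_mul.{u} hK
    have ih' (η) (hη : η < l) := ih η hη (hη.le.trans hlN)
    have htrav (η) (hη : η < l) := h.traverses η (hη.trans_le hlN)
    rw [computation_limit _ _ (hKn.map_isSuccLimit hl), ← h.limit l hlN hl]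
    refine limitSnapshot_comp_of_isNormal hKn hl ih' (fun η hη t ht ht' c => ?_)
      (fun η hη t ht ht' => ?_) fun t ht htL => ?_
    · obtain ⟨j, hj, rfl⟩ := exists_eq_natCast_mul_add ht ht'
      rw [computation_add_nat, ih' η hη]
      exact (htrav η hη).tape j hj c
    · obtain ⟨j, hj, rfl⟩ := exists_eq_natCast_mul_add ht ht'
      rw [computation_add_nat, ih' η hη]
      exact (htrav η hη).state j hj
    · obtain ⟨η, hη, hηt, htη⟩ := exists_le_lt_map_add_one hKn (by simp) ht
      obtain ⟨j, hj, rfl⟩ := exists_eq_natCast_mul_add hηt htη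
      rcases j.eq_zero_or_pos with rfl | hj0
      · exact ⟨η, by simp⟩
      · rw [computation_add_nat, ih' η hη, h.limit l hlN hl] at htL
        exact absurd (htL ▸ (htrav η hη).mem j hj hj0) (h.notMem l hlN)

theorem IsItinerary.state_mem (h : IsItinerary r K M N hub) (hK : 0 < K)
    (hhub : ∀ η < N, (hub η).state ∈ B) (hM : M ⊆ B) {t : Ordinal.{u}} (ht : t < K * N) :
    (computation r (hub 0) t).state ∈ B := by
  obtain ⟨η, hη, hηt, htη⟩ := exists_le_lt_map_add_one (isNormal_natCast_mul hK) (by simp) ht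
  obtain ⟨j, hj, rfl⟩ := exists_eq_natCast_mul_add hηt htη
  rcases j.eq_zero_or_pos with rfl | hj0
  · simpa [h.computation_mul hK η hη.le] using hhub η hη
  · rw [computation_add_nat, h.computation_mul hK η hη.le]
    exact hM ((h.traverses η hη).mem j hj hj0)

theorem IsItinerary.reaches (h : IsItinerary r K M N hub) (hK : 0 < K)
    (hhub : ∀ η < N, (hub η).state ∈ B) (hM : M ⊆ B) : Reaches r B (hub 0) (hub N) :=
  ⟨K * N, h.computation_mul hK N le_rfl, fun _ => h.state_mem hK hhub hM⟩

theorem RunsForever.of_isItinerary (h : ∀ N, IsItinerary r K M N hub) (hK : 0 < K)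
    (hhub : ∀ η, (hub η).state ∈ B) (hM : M ⊆ B) : RunsForever r B (hub 0) := fun t =>
  (h (t + 1)).state_mem hK (fun η _ => hhub η) hM <| (lt_add_one t).trans_le <|
    (isNormal_natCast_mul hK).strictMono.le_apply

end Itinerary

section Simulation

variable {S : Type v}

/-- The instruction of `p` for the state and the symbol in `q`, where an undefined instruction is
replaced by the one that changes nothing. -/
def Program.act (p : Program.{u} S) (q : Ordinal.{u} × Option S) :
    Ordinal.{u} × Option S × Motion :=
  (p.toFun q).getD (q.1, q.2, .stay)

theorem step_eq_act (p : Program.{u} S) (s : Snapshot.{u} S) :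
    step p s = ⟨Function.update s.tape s.head (p.act (s.state, s.tape s.head)).2.1,
      (p.act (s.state, s.tape s.head)).1, move (p.act (s.state, s.tape s.head)).2.2 s.head⟩ := by
  rw [step, Program.act]
  cases p.toFun (s.state, s.tape s.head) <;> simp [move]

theorem Program.exists_forall_step_state_le (p : Program.{u} S) :
    ∃ κ : Ordinal.{u}, ∀ s : Snapshot.{u} S, s.state ≤ κ → (step p s).state ≤ κ := by
  have := p.small_dom
  obtain ⟨κ, hκ⟩ := bddAbove_of_small (s := range
    fun q : {q : Ordinal.{u} × Option S // (p.toFun q).isSome} => ((p.toFun q.1).get q.2).1)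
  refine ⟨κ, fun s hs => ?_⟩
  rw [step_eq_act]
  rcases hp : p.toFun (s.state, s.tape s.head) with _ | i
  · simpa [Program.act, hp] using hs
  · simpa [Program.act, hp] using hκ ⟨⟨(s.state, s.tape s.head), by simp [hp]⟩, rfl⟩

variable [Fintype S] [LinearOrder (Option S)]

theorem Program.exists_state_lt (p : Program.{u} S) :
    ∃ κ : Ordinal.{u}, ∀ x γ, (computation p ⟨x, 0, 0⟩ γ).state < κ := by
  obtain ⟨κ, hκ⟩ := p.exists_forall_step_state_le
  refine ⟨κ + 1, fun x γ => lt_add_one_iff.2 ?_⟩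
  induction γ using limitRecOn with
  | zero => simp [computation_zero]
  | add_one γ ih =>
    rw [computation_add_one]
    exact hκ _ ih
  | limit l hl ih =>
    rw [computation_limit _ _ hl]
    refine le_of_forall_lt fun b hb => ?_
    obtain ⟨ξ, -, h⟩ := lt_ordLiminf_iff.1 hb
    exact (h ξ trivial le_rfl).trans_le (ih ξ ξ.2)

/-- A strict upper bound of the states that `p` can assume. -/
def Program.stateBound (p : Program.{u} S) : Ordinal.{u} := p.exists_state_lt.choose

theorem Program.state_lt_stateBound (p : Program.{u} S) (x : Tape.{u} S) (γ : Ordinal.{u}) :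
    (computation p ⟨x, 0, 0⟩ γ).state < p.stateBound :=
  p.exists_state_lt.choose_spec x γ

variable {r p : Program.{u} S} {K : ℕ} {M : Set Ordinal.{u}} {E : Tape.{u} S → Tape.{u} S}
  {σ g : Ordinal.{u} → Ordinal.{u}} {x y : Tape.{u} S}

/-- Until `p` halts, each step of `p` corresponds to `K` steps of `r` on the re-encoded snapshot,
with intermediate states in `M`. -/
structure Simulates (r p : Program.{u} S) (K : ℕ) (M : Set Ordinal.{u})
    (E : Tape.{u} S → Tape.{u} S) (σ g : Ordinal.{u} → Ordinal.{u}) : Prop where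
  pos : 0 < K
  isCellwise : IsCellwise E
  isNormal_state : IsNormal σ
  isNormal_head : IsNormal g
  head_zero : g 0 = 0
  notMem : ∀ δ, σ δ ∉ M
  traverses : ∀ s : Snapshot.{u} S, s.state ∈ Iio p.stateBound \ {1} →
    (step p s).state < p.stateBound → Traverses r K M (s.map E σ g) ((step p s).map E σ g)

/-- The states of the simulating program before the simulated program halts. -/
def Program.simStates (p : Program.{u} S) (M : Set Ordinal.{u}) (σ : Ordinal.{u} → Ordinal.{u}) :
    Set Ordinal.{u} :=
  M ∪ σ '' (Iio p.stateBound \ {1})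

theorem Simulates.isItinerary (h : Simulates r p K M E σ g) {N : Ordinal.{u}}
    (hN : ∀ η < N, (computation p ⟨x, 0, 0⟩ η).state ≠ 1) :
    IsItinerary r K M N fun η => (computation p ⟨x, 0, 0⟩ η).map E σ g where
  traverses η hη := by
    have hlt := p.state_lt_stateBound x (η + 1)
    rw [computation_add_one] at hlt ⊢
    exact h.traverses _ ⟨p.state_lt_stateBound x η, hN η hη⟩ hlt
  limit l _ hl := by
    rw [computation_limit _ _ hl]
    exact limitSnapshot_map h.isCellwise h.isNormal_state h.isNormal_head h.head_zero hl _
  notMem η _ := h.notMem _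

theorem Simulates.map_initial (h : Simulates r p K M E σ g) :
    (computation p ⟨x, 0, 0⟩ 0).map E σ g = ⟨E x, σ 0, 0⟩ := by
  rw [computation_zero, Snapshot.map, h.head_zero]

theorem Simulates.reaches (h : Simulates r p K M E σ g) (hy : y ∈ interp p x) :
    ∃ β, Reaches r (p.simStates M σ) ⟨E x, σ 0, 0⟩ ⟨E y, σ 1, g β⟩ := by
  obtain ⟨hne, rfl⟩ := hy
  set τ := sInf (haltTimes p x)
  have hτ : (computation p ⟨x, 0, 0⟩ τ).state = 1 := csInf_mem hne
  have hlt (η) (hη : η < τ) : (computation p ⟨x, 0, 0⟩ η).state ≠ 1 := fun h1 =>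
    notMem_of_lt_csInf' (s := haltTimes p x) hη h1
  refine ⟨(computation p ⟨x, 0, 0⟩ τ).head, ?_⟩
  have hreach := (h.isItinerary hlt).reaches (B := p.simStates M σ) h.pos
    (fun η hη => .inr ⟨_, ⟨p.state_lt_stateBound x η, hlt η hη⟩, rfl⟩) subset_union_left
  rwa [h.map_initial, Snapshot.map, hτ] at hreach

theorem Simulates.runsForever (h : Simulates r p K M E σ g) (hx : interp p x = Part.none) :
    RunsForever r (p.simStates M σ) ⟨E x, σ 0, 0⟩ := by
  have hne (η) : (computation p ⟨x, 0, 0⟩ η).state ≠ 1 := fun h1 =>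
    Part.eq_none_iff'.1 hx ⟨η, h1⟩
  have hrun := RunsForever.of_isItinerary (fun N => h.isItinerary fun η (_ : η < N) => hne η)
    h.pos (B := p.simStates M σ)
    (fun η => .inr ⟨_, ⟨p.state_lt_stateBound x η, hne η⟩, rfl⟩) subset_union_left
  rwa [h.map_initial] at hrun

end Simulation

section OfRule

variable {S : Type v} {ι : Type*}

/-- The code `ω * a + j` of the pair of `a` and `j` as a state. -/
def stateCode (a : Ordinal.{u}) (j : ℕ) : Ordinal.{u} := ω * a + j

theorem stateCode_inj {a b : Ordinal.{u}} {i j : ℕ} :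
    stateCode a i = stateCode b j ↔ a = b ∧ i = j := by
  refine ⟨fun h => ?_, by rintro ⟨rfl, rfl⟩; rfl⟩
  have hdiv := congrArg (· / ω) h
  have hmod := congrArg (· % ω) h
  simp only [stateCode, mul_add_div _ omega0_ne_zero, mul_add_mod_self,
    div_eq_zero_of_lt (natCast_lt_omega0 _), mod_eq_of_lt (natCast_lt_omega0 _), add_zero,
    Nat.cast_inj] at hdiv hmod
  exact ⟨hdiv, hmod⟩

theorem isNormal_stateCode_zero : IsNormal fun a : Ordinal.{u} => stateCode a 0 := by
  simpa [stateCode] using isNormal_mul_right omega0_pos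

theorem stateCode_zero_zero : stateCode (0 : Ordinal.{u}) 0 = 0 := by simp [stateCode]

theorem stateCode_zero_one : stateCode (0 : Ordinal.{u}) 1 = 1 := by simp [stateCode]

open Classical in
/-- The program given by a rule for control states in `ι`, which are represented by the ordinals
`st i`. -/
def Program.ofRule [Finite S] [Small.{u} ι] (st : ι → Ordinal.{u})
    (rule : ι → Option S → Ordinal.{u} × Option S × Motion) : Program.{u} S where
  toFun q := (Function.partialInv st q.1).map fun i => rule i q.2
  small_dom := by
    have hst (q : {q : Ordinal.{u} × Option S //
        ((Function.partialInv st q.1).map fun i => rule i q.2).isSome}) : q.1.1 ∈ range st := by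
      by_contra h
      simpa [Function.partialInv, mem_range.not.1 h] using q.2
    refine small_of_injective (β := range st × Option S) (f := fun q => (⟨q.1.1, hst q⟩, q.1.2))
      fun q q' h => ?_
    simpa [Subtype.ext_iff, Prod.ext_iff] using h

theorem Program.ofRule_apply [Finite S] [Small.{u} ι] {st : ι → Ordinal.{u}}
    (hst : Function.Injective st) (rule : ι → Option S → Ordinal.{u} × Option S × Motion)
    (i : ι) (a : Option S) : (Program.ofRule st rule).toFun (st i, a) = some (rule i a) := by
  simp [Program.ofRule, Function.partialInv_left hst]

end OfRule

section Comp

variable {S : Type v} [Fintype S] [LinearOrder (Option S)] {p q r : Program.{u} S}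
  {x y : Tape.{u} S}

theorem Simulates.of_toFun_eq_act {σ : Ordinal.{u} → Ordinal.{u}} (hσ : IsNormal σ)
    (h : ∀ δ ∈ Iio p.stateBound \ {1}, ∀ a,
      r.toFun (σ δ, a) = some (σ (p.act (δ, a)).1, (p.act (δ, a)).2)) :
    Simulates r p 1 ∅ id σ id where
  pos := one_pos
  isCellwise c := .inl ⟨c, fun _ => rfl⟩
  isNormal_state := hσ
  isNormal_head := .id
  head_zero := rfl
  notMem _ := notMem_empty _
  traverses s hs _ := .one <| by
    rw [step_eq_act p]
    exact step_write rfl (h _ hs _)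

/-- The control states of `Program.comp p q`: simulating `q`, returning to cell `0` by counting to
`ω`, and simulating `p`. -/
abbrev CompState (p q : Program.{u} S) := Iio q.stateBound ⊕ ℕ ⊕ Iio p.stateBound

/-- The ordinals representing the control states of `Program.comp p q`. -/
def CompState.code : CompState p q → Ordinal.{u}
  | .inl δ => stateCode δ 0
  | .inr (.inl n) => stateCode q.stateBound n
  | .inr (.inr δ) => stateCode (q.stateBound + 1 + δ) 0

theorem CompState.code_injective : Function.Injective (code : CompState p q → Ordinal.{u}) := by
  have hne {δ : Ordinal.{u}} (hδ : δ ≤ q.stateBound) (δ' : Ordinal.{u}) :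
      δ ≠ q.stateBound + 1 + δ' :=
    ((lt_add_one_iff.2 hδ).trans_le le_self_add).ne
  rintro (⟨δ, hδ⟩ | n | ⟨δ, hδ⟩) (⟨δ', hδ'⟩ | n' | ⟨δ', hδ'⟩) h <;>
    simp only [code, stateCode_inj, add_right_inj] at h
  · simp [h.1]
  · exact (hδ.ne h.1).elim
  · exact (hne hδ.le _ h.1).elim
  · exact (hδ'.ne' h.1).elim
  · simp [h.2]
  · exact (hne le_rfl _ h.1).elim
  · exact (hne hδ'.le _ h.1.symm).elim
  · exact (hne le_rfl _ h.1.symm).elim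
  · simp [h.1]

theorem one_lt_stateBound (hy : y ∈ interp q x) : 1 < q.stateBound := by
  obtain ⟨⟨t, ht⟩, -⟩ := hy
  exact ht ▸ q.state_lt_stateBound x t

theorem zero_lt_stateBound (p : Program.{u} S) : 0 < p.stateBound :=
  (zero_le).trans_lt (p.state_lt_stateBound (fun _ => none) 0)

theorem CompState.code_ne_one (c : CompState p q) : c.code ≠ 1 := by
  have hκ := (zero_lt_stateBound q).ne'
  rw [← stateCode_zero_one]
  rcases c with δ | n | δ <;> simp [code, stateCode_inj, hκ]

open Classical in
/-- The instructions of `Program.comp p q`. -/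
def CompState.rule : CompState p q → Option S → Ordinal.{u} × Option S × Motion
  | .inl δ, a => if δ.1 = 1 then (stateCode q.stateBound 0, a, .stay) else
      (stateCode (q.act (δ, a)).1 0, (q.act (δ, a)).2)
  | .inr (.inl n), a => (stateCode q.stateBound (n + 1), a, .stay)
  | .inr (.inr δ), a => if δ.1 = 1 then (1, a, .stay) else
      (stateCode (q.stateBound + 1 + (p.act (δ, a)).1) 0, (p.act (δ, a)).2)

/-- The program that runs `q` until it halts, returns to cell `0` and runs `p` there. -/
def Program.comp (p q : Program.{u} S) : Program.{u} S :=
  .ofRule (CompState.code (p := p) (q := q)) CompState.rule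

theorem comp_apply (c : CompState p q) (a : Option S) :
    (p.comp q).toFun (c.code, a) = some (c.rule a) :=
  Program.ofRule_apply CompState.code_injective _ c a

theorem comp_simulates_left (p q : Program.{u} S) :
    Simulates (p.comp q) q 1 ∅ id (stateCode · 0) id :=
  .of_toFun_eq_act isNormal_stateCode_zero fun δ ⟨hδ, h1⟩ a =>
    (comp_apply (.inl ⟨δ, hδ⟩) a).trans (congrArg some (if_neg h1))

theorem comp_simulates_right (p q : Program.{u} S) :
    Simulates (p.comp q) p 1 ∅ id (fun δ => stateCode (q.stateBound + 1 + δ) 0) id :=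
  .of_toFun_eq_act (isNormal_stateCode_zero.comp (isNormal_add_right _)) fun δ ⟨hδ, h1⟩ a =>
    (comp_apply (.inr (.inr ⟨δ, hδ⟩)) a).trans (congrArg some (if_neg h1))

theorem comp_reaches_jump (X : Tape.{u} S) (h : Ordinal.{u}) :
    Reaches (p.comp q) (CompState.code '' range fun n => (.inr (.inl n) : CompState p q))
      ⟨X, stateCode q.stateBound 0, h⟩ ⟨X, stateCode (q.stateBound + 1) 0, 0⟩ := by
  let hub (η : Ordinal.{u}) : Snapshot.{u} S := ⟨X, ω * q.stateBound + η, if η < ω then h else 0⟩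
  have hhub : IsItinerary (p.comp q) 1 ∅ ω hub :=
    { traverses η hη := by
        obtain ⟨n, rfl⟩ := lt_omega0.1 hη
        have hstep : step (p.comp q) ⟨X, stateCode q.stateBound n, h⟩ = _ :=
          step_keep rfl (comp_apply (.inr (.inl n)) _)
        refine .one ?_
        simpa [hub, hη, isSuccLimit_omega0.add_one_lt hη, stateCode, move] using hstep
      limit l hlω hl := by
        obtain rfl := hlω.antisymm (omega0_le_of_isSuccLimit hl)
        simpa [hub] using limitSnapshot_of_isNormal_state X (isNormal_add_right (ω * q.stateBound))
          (fun η => if η < ω then h else 0) hl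
      notMem _ _ := notMem_empty _ }
  have hreach := hhub.reaches one_pos
    (B := CompState.code '' range fun n => (.inr (.inl n) : CompState p q)) (fun η hη => by
      obtain ⟨n, rfl⟩ := lt_omega0.1 hη
      exact ⟨_, ⟨n, rfl⟩, rfl⟩) (empty_subset _)
  simpa [hub, stateCode, mul_add_one] using hreach

theorem comp_reaches_right (hy : y ∈ interp q x) :
    Reaches (p.comp q) (CompState.code '' (range fun c => (.inr (.inr c) : CompState p q))ᶜ)
      ⟨x, 0, 0⟩ ⟨y, stateCode (q.stateBound + 1) 0, 0⟩ := by
  obtain ⟨β, hβ⟩ := (comp_simulates_left p q).reaches hy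
  have hone : step (p.comp q) ⟨y, stateCode 1 0, β⟩ = ⟨y, stateCode q.stateBound 0, β⟩ :=
    step_keep rfl <| (comp_apply (.inl ⟨1, one_lt_stateBound hy⟩) _).trans <|
      congrArg some (if_pos rfl)
  have hfirst : Reaches (p.comp q) (CompState.code '' range (Sum.inl : _ → CompState p q))
      ⟨x, 0, 0⟩ ⟨y, stateCode q.stateBound 0, β⟩ := by
    refine ((stateCode_zero_zero ▸ hβ).mono ?_).step
      ⟨_, ⟨⟨1, one_lt_stateBound hy⟩, rfl⟩, rfl⟩ hone
    rintro _ (h | ⟨δ, hδ, rfl⟩)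
    · exact h.elim
    · exact ⟨_, ⟨⟨δ, hδ.1⟩, rfl⟩, rfl⟩
  refine (hfirst.trans (comp_reaches_jump y β) ?_ ?_).mono ?_
  · simp [disjoint_image_iff CompState.code_injective, disjoint_left]
  · simp [CompState.code, stateCode_inj, add_assoc]
  · rw [← image_union]
    exact image_mono <| by simp [subset_def]

theorem interp_comp_of_eq_none (hq : interp q x = Part.none) :
    interp (p.comp q) x = Part.none := by
  have hrun := (comp_simulates_left p q).runsForever hq
  rw [stateCode_zero_zero] at hrun
  refine hrun.interp_eq_none ?_
  rintro (h | ⟨δ, hδ, h1⟩)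
  · exact h
  · exact CompState.code_ne_one (.inl ⟨δ, hδ.1⟩ : CompState p q) h1

theorem interp_comp_of_mem (hy : y ∈ interp q x) : interp (p.comp q) x = interp p y := by
  let σ (δ : Ordinal.{u}) : Ordinal.{u} := stateCode (q.stateBound + 1 + δ) 0
  let L : Set (CompState p q) := (range fun c => .inr (.inr c))ᶜ
  let R : Set (CompState p q) := range fun c => .inr (.inr c)
  have hright : Reaches (p.comp q) (CompState.code '' L) ⟨x, 0, 0⟩ ⟨y, σ 0, 0⟩ := by
    simpa [σ] using comp_reaches_right hy
  have hdisj : Disjoint (CompState.code '' L) (CompState.code '' R) :=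
    (disjoint_image_iff CompState.code_injective).2 disjoint_compl_left
  have hsim : p.simStates ∅ σ ⊆ CompState.code '' R := by
    rintro _ (h | ⟨δ, hδ, rfl⟩)
    · exact h.elim
    · exact ⟨_, ⟨⟨δ, hδ.1⟩, rfl⟩, rfl⟩
  have hnot_one : 1 ∉ CompState.code '' L ∪ CompState.code '' R := by
    rw [← image_union]
    exact fun ⟨c, _, h1⟩ => c.code_ne_one h1
  rcases (interp p y).eq_none_or_eq_some with hp | ⟨z, hp⟩ <;> rw [hp]
  · have hrun := (comp_simulates_right p q).runsForever hp
    exact (hright.runsForever (fun t => hsim (hrun t)) hdisj).interp_eq_none hnot_one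
  · have hz := Part.eq_some_iff.1 hp
    obtain ⟨β, hβ⟩ := (comp_simulates_right p q).reaches hz
    have hone : σ 1 ∈ CompState.code '' R := ⟨_, ⟨⟨1, one_lt_stateBound hz⟩, rfl⟩, rfl⟩
    have hhalt : step (p.comp q) ⟨z, σ 1, β⟩ = ⟨z, 1, β⟩ :=
      step_keep rfl <| (comp_apply (.inr (.inr ⟨1, one_lt_stateBound hz⟩)) _).trans <|
        congrArg some (if_pos rfl)
    exact ((hright.trans (hβ.mono hsim) hdisj (hdisj.notMem_of_mem_right hone)).step
      (.inr hone) hhalt).interp_eq_some hnot_one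

theorem mem_interp_comp {z : Tape.{u} S} :
    z ∈ interp (p.comp q) x ↔ ∃ y ∈ interp q x, z ∈ interp p y := by
  rcases (interp q x).eq_none_or_eq_some with hq | ⟨y, hq⟩
  · simp [interp_comp_of_eq_none hq, hq]
  · simp [interp_comp_of_mem (Part.eq_some_iff.1 hq), hq]

end Comp

section Move

theorem move_right (β : Ordinal.{u}) : move .right β = β + 1 := rfl

theorem move_left_zero : move .left (0 : Ordinal.{u}) = 0 := by
  simp [move]

theorem move_left_add_one (β : Ordinal.{u}) : move .left (β + 1) = β := by
  simp [move, limitRecOn_add_one]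

theorem move_left_limit {β : Ordinal.{u}} (h : IsSuccLimit β) : move .left β = 0 := by
  simp [move, limitRecOn_limit, h]

theorem two_mul_add_one (β : Ordinal.{u}) : 2 * (β + 1) = 2 * β + 1 + 1 := by
  rw [mul_add_one, add_assoc, one_add_one_eq_two]

theorem move_move_two_mul (m : Motion) (β : Ordinal.{u}) :
    move m (move m (2 * β)) = 2 * move m β := by
  cases m with
  | stay => rfl
  | right => exact (two_mul_add_one β).symm
  | left =>
    induction β using limitRecOn with
    | zero => simp [move_left_zero]
    | add_one β => simp only [two_mul_add_one, move_left_add_one]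
    | limit β hβ =>
      rw [move_left_limit hβ, move_left_limit ((isNormal_mul_right two_pos).map_isSuccLimit hβ),
        move_left_zero, mul_zero]

end Move

section Interleave

variable {S : Type v}

theorem two_mul_add_one_mod_two (η : Ordinal.{u}) : (2 * η + 1) % 2 = 1 := by
  rw [mul_add_mod_self, mod_eq_of_lt one_lt_two]

theorem two_mul_ne_two_mul_add_one (η ξ : Ordinal.{u}) : 2 * η ≠ 2 * ξ + 1 := fun h => by
  have := mul_mod 2 η
  rw [h, two_mul_add_one_mod_two] at this
  exact one_ne_zero this

theorem eq_two_mul_or_eq_two_mul_add_one (c : Ordinal.{u}) :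
    ∃ η, c = 2 * η ∨ c = 2 * η + 1 := by
  refine ⟨c / 2, ?_⟩
  have hmod : c % 2 < 1 + 1 := by simpa [one_add_one_eq_two] using mod_lt c two_ne_zero
  rcases (lt_add_one_iff.1 hmod).lt_or_eq with h | h
  · exact .inl (by simpa [lt_one_iff.1 h] using (div_add_mod c 2).symm)
  · exact .inr (by simpa [h] using (div_add_mod c 2).symm)

open Classical in
/-- The tape content with the cells of `Y` in the even positions (which include the limits) and the
cells of `Z` in the odd ones. -/
def interleave (Y Z : Tape.{u} S) : Tape.{u} S :=
  fun c => if c % 2 = 0 then Y (c / 2) else Z (c / 2)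

variable (Y Z : Tape.{u} S) (η : Ordinal.{u})

theorem interleave_two_mul : interleave Y Z (2 * η) = Y η := by
  rw [interleave, if_pos (mul_mod _ _), mul_div_cancel _ two_ne_zero]

theorem interleave_two_mul_add_one : interleave Y Z (2 * η + 1) = Z η := by
  have : (2 * η + 1) % 2 ≠ 0 := (two_mul_add_one_mod_two η).trans_ne one_ne_zero
  rw [interleave, if_neg this, mul_add_div _ two_ne_zero, div_eq_zero_of_lt one_lt_two, add_zero]

variable {Y Z}

theorem eq_interleave {X : Tape.{u} S} (heven : ∀ η, X (2 * η) = Y η)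
    (hodd : ∀ η, X (2 * η + 1) = Z η) : X = interleave Y Z := by
  funext c
  obtain ⟨η, rfl | rfl⟩ := eq_two_mul_or_eq_two_mul_add_one c
  · rw [heven, interleave_two_mul]
  · rw [hodd, interleave_two_mul_add_one]

theorem isCellwise_interleave (Z : Tape.{u} S) : IsCellwise (interleave · Z) := fun c => by
  obtain ⟨η, rfl | rfl⟩ := eq_two_mul_or_eq_two_mul_add_one c
  · exact .inl ⟨η, fun Y => interleave_two_mul Y Z η⟩
  · exact .inr ⟨Z η, fun Y => interleave_two_mul_add_one Y Z η⟩

theorem update_interleave_two_mul (a : Option S) :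
    Function.update (interleave Y Z) (2 * η) a = interleave (Function.update Y η a) Z := by
  refine eq_interleave (fun ξ => ?_) fun ξ => ?_
  · simp [Function.update_apply, interleave_two_mul]
  · simp [interleave_two_mul_add_one, (two_mul_ne_two_mul_add_one η ξ).symm]

end Interleave

section Even

variable {S : Type v} [Fintype S] [LinearOrder (Option S)] {p : Program.{u} S}

/-- The control states of `Program.even p`: the states of `p`, together with the motion token that
has to be applied a second time, if any. -/
abbrev EvenState (p : Program.{u} S) := Iio p.stateBound × Option Motion

/-- The numbers that tell apart the codes of the control states of `Program.even p` for one state of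
`p`; the number `1` is avoided, since `stateCode 0 1` is the halt state. -/
def EvenState.offset : Option Motion → ℕ
  | none => 0
  | some .left => 2
  | some .stay => 3
  | some .right => 4

/-- The ordinals representing the control states of `Program.even p`. -/
def EvenState.code (c : EvenState p) : Ordinal.{u} := stateCode c.1 (offset c.2)

open Classical in
/-- The instructions of `Program.even p`. -/
def EvenState.rule : EvenState p → Option S → Ordinal.{u} × Option S × Motion
  | (δ, none), a => if δ.1 = 1 then (1, a, .stay) else
      (stateCode (p.act (δ, a)).1 (offset (p.act (δ, a)).2.2), (p.act (δ, a)).2)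
  | (δ, some m), a => (stateCode δ 0, a, m)

/-- The program that runs `p` on the even cells of the tape. -/
def Program.even (p : Program.{u} S) : Program.{u} S :=
  .ofRule (EvenState.code (p := p)) EvenState.rule

theorem EvenState.code_injective : Function.Injective (code (p := p)) := by
  have hoffset : Function.Injective offset := by
    rintro (_ | _ | _ | _) (_ | _ | _ | _) <;> simp [offset]
  rintro ⟨δ, m⟩ ⟨δ', m'⟩ h
  obtain ⟨hδ, hm⟩ := stateCode_inj.1 h
  exact Prod.ext (Subtype.ext hδ) (hoffset hm)

theorem EvenState.code_ne_one (c : EvenState p) : c.code ≠ 1 := by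
  rw [← stateCode_zero_one]
  rcases c with ⟨δ, _ | _ | _ | _⟩ <;> simp [code, offset, stateCode_inj]

theorem even_apply (c : EvenState p) (a : Option S) :
    p.even.toFun (c.code, a) = some (c.rule a) :=
  Program.ofRule_apply EvenState.code_injective _ c a

theorem even_simulates (p : Program.{u} S) (Z : Tape.{u} S) :
    Simulates p.even p 2 (EvenState.code '' {c : EvenState p | c.2.isSome}) (interleave · Z)
      (stateCode · 0) (2 * ·) where
  pos := two_pos
  isCellwise := isCellwise_interleave Z
  isNormal_state := isNormal_stateCode_zero
  isNormal_head := isNormal_mul_right two_pos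
  head_zero := mul_zero 2
  notMem δ := by
    rintro ⟨⟨δ', _ | _ | _ | _⟩, hm, h⟩ <;>
      simp [EvenState.code, EvenState.offset, stateCode_inj] at hm h
  traverses s hs hlt := by
    rw [step_eq_act] at hlt ⊢
    set i := p.act (s.state, s.tape s.head) with hi
    have hread : interleave s.tape Z (2 * s.head) = s.tape s.head := interleave_two_mul _ _ _
    have hwrite : step p.even ⟨interleave s.tape Z, stateCode s.state 0, 2 * s.head⟩ =
        ⟨interleave (Function.update s.tape s.head i.2.1) Z,
          stateCode i.1 (EvenState.offset i.2.2), move i.2.2 (2 * s.head)⟩ := by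
      rw [← update_interleave_two_mul, hi]
      exact step_write hread <| (even_apply (⟨s.state, hs.1⟩, none) _).trans <|
        congrArg some (if_neg hs.2)
    have hmove : step p.even ⟨interleave (Function.update s.tape s.head i.2.1) Z,
          stateCode i.1 (EvenState.offset i.2.2), move i.2.2 (2 * s.head)⟩ =
        ⟨interleave (Function.update s.tape s.head i.2.1) Z, stateCode i.1 0,
          2 * move i.2.2 s.head⟩ := by
      rw [← move_move_two_mul]
      exact step_keep rfl (even_apply (⟨i.1, hlt⟩, some i.2.2) _)
    have hle : stateCode i.1 0 ≤ stateCode i.1 (EvenState.offset i.2.2) := by simp [stateCode]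
    exact .two hwrite hmove (fun c => .inr rfl) (.inr hle)
      ⟨(⟨i.1, hlt⟩, some i.2.2), rfl, rfl⟩

theorem interp_even (p : Program.{u} S) (Y Z : Tape.{u} S) :
    interp p.even (interleave Y Z) = (interp p Y).map (interleave · Z) := by
  have hsim := even_simulates p Z
  have hstates : p.simStates (EvenState.code '' {c : EvenState p | c.2.isSome}) (stateCode · 0) ⊆
      range (EvenState.code (p := p)) := by
    rintro _ (⟨c, -, rfl⟩ | ⟨δ, hδ, rfl⟩)
    · exact ⟨c, rfl⟩
    · exact ⟨(⟨δ, hδ.1⟩, none), rfl⟩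
  have hnot_one : 1 ∉ range (EvenState.code (p := p)) := fun ⟨c, h⟩ => c.code_ne_one h
  rcases (interp p Y).eq_none_or_eq_some with hp | ⟨z, hp⟩
  · have hrun := hsim.runsForever hp
    rw [stateCode_zero_zero] at hrun
    rw [hp, Part.map_none, hrun.interp_eq_none fun h => hnot_one (hstates h)]
  · have hz := Part.eq_some_iff.1 hp
    obtain ⟨β, hβ⟩ := hsim.reaches hz
    rw [stateCode_zero_zero] at hβ
    have hhalt : step p.even ⟨interleave z Z, stateCode 1 0, 2 * β⟩ =
        ⟨interleave z Z, 1, 2 * β⟩ :=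
      step_keep rfl <| (even_apply (⟨1, one_lt_stateBound hz⟩, none) _).trans <|
        congrArg some (if_pos rfl)
    rw [hp, Part.map_some]
    exact ((hβ.mono hstates).step ⟨(⟨1, one_lt_stateBound hz⟩, none), rfl⟩ hhalt).interp_eq_some
      hnot_one

end Even

section Walk

variable {S : Type v} [Fintype S] [LinearOrder (Option S)] {r : Program.{u} S} {K : ℕ}
  {M : Set Ordinal.{u}} {N q : Ordinal.{u}} {X : Tape.{u} S} {Y : Ordinal.{u} → Tape.{u} S}
  {f : Ordinal.{u} → Ordinal.{u}}

theorem IsItinerary.of_const_state (hf : IsNormal f) (hq : q ∉ M)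
    (htrav : ∀ η < N, Traverses r K M ⟨Y η, q, f η⟩ ⟨Y (η + 1), q, f (η + 1)⟩)
    (hY : ∀ l ≤ N, IsSuccLimit l → ∀ c, ∀ᶠ ξ in 𝓝[<] l, Y ξ c = Y l c) :
    IsItinerary r K M N fun η => ⟨Y η, q, f η⟩ where
  traverses := htrav
  limit l hl hlim := limitSnapshot_of_const_state hf hlim (hY l hl hlim)
  notMem _ _ := hq

theorem Reaches.walk (hf : IsNormal f)
    (hstep : ∀ η < N, SymMachine.step r ⟨Y η, q, f η⟩ = ⟨Y (η + 1), q, f (η + 1)⟩)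
    (hY : ∀ l ≤ N, IsSuccLimit l → ∀ c, ∀ᶠ ξ in 𝓝[<] l, Y ξ c = Y l c) :
    Reaches r {q} ⟨Y 0, q, f 0⟩ ⟨Y N, q, f N⟩ :=
  (IsItinerary.of_const_state hf (notMem_empty q) (fun η hη => .one (hstep η hη)) hY).reaches
    one_pos (fun _ _ => mem_singleton q) (empty_subset _)

end Walk

section Mark

variable {S : Type v} (o : S)

/-- The control states of `Program.mark`. -/
inductive MarkState
  | start
  | skip
  | write

/-- The ordinals representing the control states of `Program.mark`. -/
def MarkState.code : MarkState → Ordinal.{u}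
  | start => stateCode 0 0
  | skip => stateCode 0 2
  | write => stateCode 0 3

/-- The instructions of `Program.mark`. -/
def MarkState.rule : MarkState → Option S → Ordinal.{u} × Option S × Motion
  | start, none => (skip.code, none, .right)
  | start, some s => (write.code, some s, .right)
  | skip, a => (start.code, a, .right)
  | write, _ => (1, some o, .stay)

theorem MarkState.code_injective : Function.Injective code := by
  rintro (_ | _ | _) (_ | _ | _) <;> simp [code, stateCode_inj]

theorem MarkState.code_ne_one (c : MarkState) : c.code ≠ 1 := by
  rw [← stateCode_zero_one]
  rcases c with _ | _ | _ <;> simp [code, stateCode_inj]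

theorem one_notMem_range_markState_code : 1 ∉ range MarkState.code := fun ⟨c, h⟩ => c.code_ne_one h

/-- The program that searches the even cells for a symbol and writes `o` into the cell following the
first one it finds. -/
def Program.mark [Finite S] : Program.{u} S := .ofRule MarkState.code (MarkState.rule o)

theorem mark_apply [Finite S] (c : MarkState) (a : Option S) :
    (Program.mark o : Program.{u} S).toFun (c.code, a) = some (c.rule o a) :=
  Program.ofRule_apply MarkState.code_injective.{u} _ c a

variable [Fintype S] [LinearOrder (Option S)]

theorem mark_isItinerary {X : Tape.{u} S} {N : Ordinal.{u}} (hX : ∀ η < N, X (2 * η) = none) :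
    IsItinerary (Program.mark o) 2 {MarkState.skip.code} N
      fun η => ⟨X, MarkState.start.code, 2 * η⟩ := by
  refine .of_const_state (isNormal_mul_right two_pos)
    (MarkState.code_injective.ne nofun) (fun η hη => ?_) fun _ _ _ _ => .of_forall fun _ => rfl
  have hstart : step (Program.mark o) ⟨X, MarkState.start.code, 2 * η⟩ =
      ⟨X, MarkState.skip.code, 2 * η + 1⟩ := step_keep (hX η hη) (mark_apply o .start none)
  have hskip : step (Program.mark o) ⟨X, MarkState.skip.code, 2 * η + 1⟩ =
      ⟨X, MarkState.start.code, 2 * (η + 1)⟩ := by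
    rw [two_mul_add_one]
    exact step_keep rfl (mark_apply o .skip _)
  exact .two hstart hskip (fun _ => .inl rfl)
    (.inl (by simp [MarkState.code, stateCode])) rfl

theorem markState_start_code : MarkState.start.code = (0 : Ordinal.{u}) := stateCode_zero_zero

theorem interp_mark_two_mul (β : Ordinal.{u}) : interp (Program.mark o) (ordTape o (2 * β)) =
    Part.some (interleave (ordTape o β) (ordTape o β)) := by
  set X := ordTape o (2 * β) with hX
  have hwalk : Reaches (Program.mark o) (range MarkState.code) ⟨X, 0, 0⟩
      ⟨X, MarkState.start.code, 2 * β⟩ := by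
    have hblank (η : Ordinal.{u}) (hη : η < β) : X (2 * η) = none :=
      if_neg ((isNormal_mul_right two_pos).strictMono hη).ne
    simpa [markState_start_code] using (mark_isItinerary o hblank).reaches two_pos
      (B := range MarkState.code) (fun _ _ => ⟨.start, rfl⟩) (singleton_subset_iff.2 ⟨_, rfl⟩)
  have hfound : step (Program.mark o) ⟨X, MarkState.start.code, 2 * β⟩ =
      ⟨X, MarkState.write.code, 2 * β + 1⟩ := step_keep (if_pos rfl) (mark_apply o .start (some o))
  have hwrite : step (Program.mark o) ⟨X, MarkState.write.code, 2 * β + 1⟩ =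
      ⟨Function.update X (2 * β + 1) (some o), 1, 2 * β + 1⟩ :=
    step_write rfl (mark_apply o .write _)
  have htape : Function.update X (2 * β + 1) (some o) =
      interleave (ordTape o β) (ordTape o β) := by
    refine eq_interleave (fun η => ?_) fun η => ?_
    · simp [hX, ordTape, two_mul_ne_two_mul_add_one]
    · simp [hX, ordTape, Function.update_apply, (two_mul_ne_two_mul_add_one β η).symm]
  rw [← htape]
  exact ((hwalk.step ⟨.start, rfl⟩ hfound).step ⟨.write, rfl⟩ hwrite).interp_eq_some
    one_notMem_range_markState_code

theorem interp_mark_two_mul_add_one (β : Ordinal.{u}) :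
    interp (Program.mark o) (ordTape o (2 * β + 1)) = Part.none := by
  have hblank (η : Ordinal.{u}) : ordTape o (2 * β + 1) (2 * η) = none :=
    if_neg (two_mul_ne_two_mul_add_one η β)
  have hrun := RunsForever.of_isItinerary (B := range MarkState.code)
    (fun N => mark_isItinerary o fun η (_ : η < N) => hblank η) two_pos (fun _ => ⟨.start, rfl⟩)
    (singleton_subset_iff.2 ⟨_, rfl⟩)
  rw [mul_zero, markState_start_code] at hrun
  exact hrun.interp_eq_none one_notMem_range_markState_code

end Mark

section Halve

variable {S : Type v} (o : S)

/-- The control states of `Program.halve`. -/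
inductive HalveState
  | start
  | scan
  | count (j : ℕ)
  | seek (n : ℕ)
  | back (n : ℕ)

/-- The ordinals representing the control states of `Program.halve`. -/
def HalveState.code : HalveState → Ordinal.{u}
  | start => stateCode 0 0
  | scan => stateCode 0 2
  | count j => stateCode 1 j
  | seek n => stateCode 2 n
  | back n => stateCode 3 n

/-- The instructions of `Program.halve`. -/
def HalveState.rule : HalveState → Option S → Ordinal.{u} × Option S × Motion
  | start, a => (scan.code, a, .right)
  | scan, none => (scan.code, none, .right)
  | scan, some s => ((count 1).code, some s, .left)
  | count j, none => ((count (j + 1)).code, none, .left)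
  | count j, some _ => ((seek ((j - 1) / 2)).code, none, .stay)
  | seek n, none => ((seek n).code, none, .right)
  | seek n, some _ => ((back n).code, none, .left)
  | back (n + 1), a => ((back n).code, a, .left)
  | back 0, _ => (1, some o, .stay)

theorem HalveState.code_injective : Function.Injective code := by
  rintro (_ | _ | _ | _ | _) (_ | _ | _ | _ | _) <;> simp [code, stateCode_inj]

theorem HalveState.code_ne_one (c : HalveState) : c.code ≠ 1 := by
  rw [← stateCode_zero_one]
  rcases c with _ | _ | _ | _ | _ <;> simp [code, stateCode_inj]

/-- The program that replaces the two symbols in the cells `0` and `2 * β + 1` by the symbol `o` in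
cell `β`. Going left from the latter, it counts the steps that it takes to arrive at cell `0`, where
it is sent from the first limit it encounters. Thus it learns the finite part `n` of `β`, and `n`
steps to the left from cell `2 * β` lead to cell `β`. -/
def Program.halve [Finite S] : Program.{u} S := .ofRule HalveState.code (HalveState.rule o)

theorem halve_apply [Finite S] (c : HalveState) (a : Option S) :
    (Program.halve o : Program.{u} S).toFun (c.code, a) = some (c.rule o a) :=
  Program.ofRule_apply HalveState.code_injective.{u} _ c a

theorem interleave_ordTape (β : Ordinal.{u}) {c : Ordinal.{u}} :
    interleave (ordTape o 0) (ordTape o β) c =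
      open Classical in if c = 0 ∨ c = 2 * β + 1 then some o else none := by
  obtain ⟨η, rfl | rfl⟩ := eq_two_mul_or_eq_two_mul_add_one c
  · simp [interleave_two_mul, ordTape, two_mul_ne_two_mul_add_one]
  · simp [interleave_two_mul_add_one, ordTape]

variable [Fintype S] [LinearOrder (Option S)]

theorem halve_reaches_back (X : Tape.{u} S) (ξ : Ordinal.{u}) (n : ℕ) :
    Reaches (Program.halve o) (HalveState.code '' range .back)
      ⟨X, (HalveState.back n).code, ξ + n⟩ ⟨Function.update X ξ (some o), 1, ξ⟩ := by
  let f (i : ℕ) : Snapshot.{u} S := ⟨X, (HalveState.back (n - i)).code, ξ + (n - i : ℕ)⟩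
  have hsteps := (Reaches.refl (Program.halve o) (HalveState.code '' range .back) (f 0)).steps
    (n := n) (fun i _ => ⟨_, ⟨_, rfl⟩, rfl⟩) fun i hi => by
      obtain ⟨k, hk⟩ : ∃ k, n - i = k + 1 := ⟨n - i - 1, by omega⟩
      have hk' : n - (i + 1) = k := by omega
      simp only [f, hk, hk', Nat.cast_succ, ← add_assoc]
      rw [step_keep rfl (halve_apply o (.back (k + 1)) _), move_left_add_one]
  have hwrite : step (Program.halve o) ⟨X, (HalveState.back 0).code, ξ⟩ =
      ⟨Function.update X ξ (some o), 1, ξ⟩ := step_write rfl (halve_apply o (.back 0) _)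
  exact Reaches.step (by simpa [f] using hsteps) ⟨_, ⟨0, rfl⟩, rfl⟩ hwrite

theorem halve_reaches_seek {X : Tape.{u} S} {P : Ordinal.{u}} {a : S} (n : ℕ)
    (hX : ∀ c < P, X c = none) (ha : X P = some a) :
    Reaches (Program.halve o) (HalveState.code '' range .seek) ⟨X, (HalveState.seek n).code, 0⟩
      ⟨Function.update X P none, (HalveState.back n).code, move .left P⟩ := by
  have hmem : (HalveState.seek n).code ∈ HalveState.code '' range .seek := ⟨_, ⟨n, rfl⟩, rfl⟩
  have hwalk : Reaches (Program.halve o) {(HalveState.seek n).code}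
      ⟨X, (HalveState.seek n).code, 0⟩ ⟨X, (HalveState.seek n).code, P⟩ :=
    Reaches.walk (Y := fun _ => X) .id
      (fun η hη => step_keep (hX η hη) (halve_apply o (.seek n) none))
      fun _ _ _ _ => .of_forall fun _ => rfl
  exact (hwalk.mono (singleton_subset_iff.2 hmem)).step hmem
    (step_write ha (halve_apply o (.seek n) (some a)))

theorem halve_reaches_scan {X : Tape.{u} S} {ξ : Ordinal.{u}} {a : S}
    (hX : ∀ c, c ≠ 0 → c ≤ ξ → X c = none) (ha : X (ξ + 1) = some a) :
    Reaches (Program.halve o) (HalveState.code '' {.start, .scan}) ⟨X, 0, 0⟩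
      ⟨X, (HalveState.count 1).code, ξ⟩ := by
  obtain ⟨N, hN⟩ : ∃ N, 1 + N = ξ + 1 := ⟨ξ + 1 - 1, Ordinal.add_sub_cancel_of_le le_add_self⟩
  have hstart : step (Program.halve o) ⟨X, HalveState.start.code, 0⟩ =
      ⟨X, HalveState.scan.code, 1 + 0⟩ := by
    rw [step_keep rfl (halve_apply o .start _), move_right, zero_add, add_zero]
  have hwalk : Reaches (Program.halve o) {HalveState.scan.code}
      ⟨X, HalveState.scan.code, 1 + 0⟩ ⟨X, HalveState.scan.code, 1 + N⟩ := by
    refine Reaches.walk (Y := fun _ => X) (isNormal_add_right 1) (fun η hη => ?_)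
      fun _ _ _ _ => .of_forall fun _ => rfl
    have hlt : 1 + η < ξ + 1 := hN ▸ (add_lt_add_iff_left 1).2 hη
    rw [← add_assoc]
    exact step_keep (hX _ (by simp) (lt_add_one_iff.1 hlt)) (halve_apply o .scan none)
  have hfound : step (Program.halve o) ⟨X, HalveState.scan.code, 1 + N⟩ =
      ⟨X, (HalveState.count 1).code, ξ⟩ := by
    rw [hN, step_keep ha (halve_apply o .scan (some a)), move_left_add_one]
  have hfirst : Reaches (Program.halve o) {HalveState.start.code} ⟨X, HalveState.start.code, 0⟩
      ⟨X, HalveState.scan.code, 1 + 0⟩ := (Reaches.refl _ _ _).step (mem_singleton _) hstart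
  have hne : HalveState.scan.code ∉ ({HalveState.start.code} : Set Ordinal.{u}) :=
    HalveState.code_injective.ne nofun
  have hall := (hfirst.trans hwalk (disjoint_singleton_right.2 hne) hne).step (.inr rfl) hfound
  rw [singleton_union, ← image_pair] at hall
  exact stateCode_zero_zero ▸ hall

theorem halve_reaches_count {X : Tape.{u} S} {ξ : Ordinal.{u}} {n : ℕ} {a : S}
    (hξ : ξ = 0 ∨ IsSuccLimit ξ) (hX : ∀ c, c ≠ 0 → c ≤ ξ + (2 * n : ℕ) → X c = none)
    (ha : X 0 = some a) :
    Reaches (Program.halve o) (HalveState.code '' range .count)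
      ⟨X, (HalveState.count 1).code, ξ + (2 * n : ℕ)⟩
      ⟨Function.update X 0 none, (HalveState.seek n).code, 0⟩ := by
  let f (i : ℕ) : Snapshot.{u} S := ⟨X, (HalveState.count (i + 1)).code, ξ + (2 * n - i : ℕ)⟩
  have hsteps := (Reaches.refl (Program.halve o) (HalveState.code '' range .count) (f 0)).steps
    (n := 2 * n) (fun i _ => ⟨_, ⟨_, rfl⟩, rfl⟩) fun i hi => by
      obtain ⟨k, hk⟩ : ∃ k, 2 * n - i = k + 1 := ⟨2 * n - i - 1, by omega⟩
      have hk' : 2 * n - (i + 1) = k := by omega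
      have hblank : X (ξ + k + 1) = none := hX _ (by simp) <| by
        rw [add_assoc]
        gcongr
        exact_mod_cast (by omega : k + 1 ≤ 2 * n)
      simp only [f, hk, hk', Nat.cast_succ, ← add_assoc]
      rw [step_keep hblank (halve_apply o (.count (i + 1)) none), move_left_add_one]
  have hzero (j : ℕ) (hj : (j - 1) / 2 = n) : step (Program.halve o)
      ⟨X, (HalveState.count j).code, 0⟩ =
        ⟨Function.update X 0 none, (HalveState.seek n).code, 0⟩ := by
    rw [← hj]
    exact step_write ha (halve_apply o (.count j) (some a))
  replace hsteps : Reaches (Program.halve o) (HalveState.code '' range .count)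
      ⟨X, (HalveState.count 1).code, ξ + (2 * n : ℕ)⟩
      ⟨X, (HalveState.count (2 * n + 1)).code, ξ⟩ := by simpa [f] using hsteps
  rcases hξ with rfl | hξ
  · exact hsteps.step ⟨_, ⟨_, rfl⟩, rfl⟩ (hzero (2 * n + 1) (by omega))
  · have hjump : step (Program.halve o) ⟨X, (HalveState.count (2 * n + 1)).code, ξ⟩ =
        ⟨X, (HalveState.count (2 * n + 2)).code, 0⟩ := by
      rw [step_keep (hX ξ hξ.ne_bot le_self_add) (halve_apply o (.count (2 * n + 1)) none),
        move_left_limit hξ]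
    exact (hsteps.step ⟨_, ⟨_, rfl⟩, rfl⟩ hjump).step ⟨_, ⟨_, rfl⟩, rfl⟩
      (hzero (2 * n + 2) (by omega))

theorem exists_eq_limit_add_natCast (β : Ordinal.{u}) :
    ∃ (ξ : Ordinal.{u}) (n : ℕ), (ξ = 0 ∨ IsSuccLimit ξ) ∧ β = ξ + n ∧ 2 * β = ξ + (2 * n : ℕ) := by
  obtain ⟨n, hn⟩ := lt_omega0.1 (mod_lt β omega0_ne_zero)
  have hβ : β = ω * (β / ω) + n := by rw [← hn, div_add_mod]
  refine ⟨ω * (β / ω), n, ?_, hβ, ?_⟩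
  · rcases eq_or_ne (β / ω) 0 with h | h
    · exact .inl (by rw [h, mul_zero])
    · exact .inr (isSuccLimit_mul_left isSuccLimit_omega0 (pos_iff_ne_zero.2 h))
  · conv_lhs => rw [hβ]
    rw [mul_add, ← mul_assoc, mul_omega0 two_pos (natCast_lt_omega0 2)]
    norm_cast

theorem interp_halve (β : Ordinal.{u}) :
    interp (Program.halve o) (interleave (ordTape o 0) (ordTape o β)) =
      Part.some (ordTape o β) := by
  obtain ⟨ξ, n, hξ, hβ, htwo⟩ := exists_eq_limit_add_natCast β
  have htwo' : 2 * β = β + n := by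
    conv_rhs => rw [hβ]
    rw [htwo, two_mul, Nat.cast_add, add_assoc]
  have htape {c : Ordinal.{u}} := interleave_ordTape o β (c := c)
  set X := interleave (ordTape o 0) (ordTape o β)
  have hblank : Function.update (Function.update X 0 none) (2 * β + 1) none = fun _ => none := by
    funext c
    simp only [Function.update_apply, htape]
    split_ifs <;> simp_all
  have hresult : Function.update (fun _ => none) β (some o) = ordTape o β := by
    funext c
    simp [Function.update_apply, ordTape]
  have hscan := halve_reaches_scan o (X := X) (ξ := 2 * β) (a := o)
    (fun c h0 hc => by simp [htape, h0, (lt_add_one_iff.2 hc).ne]) (by simp [htape])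
  have hcount := halve_reaches_count o (X := X) (n := n) (a := o) hξ
    (fun c h0 hc => by simp [htape, h0, (lt_add_one_iff.2 (hc.trans_eq htwo.symm)).ne])
    (by simp [htape])
  have hseek := halve_reaches_seek o (X := Function.update X 0 none) (P := 2 * β + 1) (a := o) n
    (fun c hc => by by_cases h : c = 0 <;> simp [htape, h, hc.ne]) (by simp [htape])
  have hback := halve_reaches_back o (fun _ => none) β n
  rw [← htwo] at hcount
  rw [move_left_add_one, hblank] at hseek
  rw [← htwo', hresult] at hback
  refine (hscan.trans (hcount.trans (hseek.trans hback ?_ ?_) ?_ ?_) ?_ ?_).interp_eq_some ?_ <;>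
    simp [disjoint_image_iff HalveState.code_injective, disjoint_left, ← image_union,
      HalveState.code_ne_one]

end Halve

section Erase

variable {S : Type v} (o : S)

/-- The control states of `Program.erase`. -/
inductive EraseState
  | start
  | erase

/-- The ordinals representing the control states of `Program.erase`. -/
def EraseState.code : EraseState → Ordinal.{u}
  | start => stateCode 0 0
  | erase => stateCode 0 2

/-- The instructions of `Program.erase`. -/
def EraseState.rule : EraseState → Option S → Ordinal.{u} × Option S × Motion
  | start, _ => (erase.code, some o, .right)
  | erase, some _ => (erase.code, none, .right)
  | erase, none => (1, none, .stay)

theorem EraseState.code_injective : Function.Injective code := by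
  rintro (_ | _) (_ | _) <;> simp [code, stateCode_inj]

theorem EraseState.code_ne_one (c : EraseState) : c.code ≠ 1 := by
  rw [← stateCode_zero_one]
  rcases c with _ | _ <;> simp [code, stateCode_inj]

/-- The program that replaces its input word by the word of length one with entry `o`. -/
def Program.erase [Finite S] : Program.{u} S := .ofRule EraseState.code (EraseState.rule o)

theorem erase_apply [Finite S] (c : EraseState) (a : Option S) :
    (Program.erase o : Program.{u} S).toFun (c.code, a) = some (c.rule o a) :=
  Program.ofRule_apply EraseState.code_injective.{u} _ c a

open Classical in
/-- The tape content obtained from `X` by writing the symbol `o` into cell `0` and erasing the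
cells strictly between `0` and `ξ`. -/
def erasedBelow (X : Tape.{u} S) (ξ : Ordinal.{u}) : Tape.{u} S :=
  fun c => if c = 0 then some o else if c < ξ then none else X c

theorem erasedBelow_one (X : Tape.{u} S) : erasedBelow o X 1 = Function.update X 0 (some o) := by
  funext c
  rcases eq_or_ne c 0 with rfl | hc <;> simp [erasedBelow, *]

theorem erasedBelow_add_one (X : Tape.{u} S) {ξ : Ordinal.{u}} (hξ : ξ ≠ 0) :
    erasedBelow o X (ξ + 1) = Function.update (erasedBelow o X ξ) ξ none := by
  funext c
  rcases eq_or_ne c ξ with rfl | hc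
  · simp [erasedBelow, hξ]
  · simp [erasedBelow, hc, lt_add_one_iff, hc.le_iff_lt]

variable [Fintype S] [LinearOrder (Option S)]

theorem erase_reaches {X : Tape.{u} S} {N : Ordinal.{u}} (hX : ∀ η < N, (X (1 + η)).isSome) :
    Reaches (Program.erase o) {EraseState.erase.code}
      ⟨erasedBelow o X (1 + 0), EraseState.erase.code, 1 + 0⟩
      ⟨erasedBelow o X (1 + N), EraseState.erase.code, 1 + N⟩ := by
  refine Reaches.walk (Y := fun η => erasedBelow o X (1 + η)) (isNormal_add_right 1)
    (fun η hη => ?_) fun l _ hl c => ?_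
  · obtain ⟨a, ha⟩ := Option.isSome_iff_exists.1 (hX η hη)
    have hread : erasedBelow o X (1 + η) (1 + η) = some a := by simp [erasedBelow, ha]
    rw [← add_assoc, erasedBelow_add_one o X (by simp)]
    exact step_write hread (erase_apply o .erase (some a))
  · rcases lt_or_ge c (1 + l) with hc | hc
    · filter_upwards [eventually_lt_of_isNormal (isNormal_add_right 1) hl hc] with η hη
      simp only [erasedBelow, hη, hc, if_true]
    · filter_upwards [self_mem_nhdsWithin] with η hη
      have hη' : 1 + η ≤ c := ((add_lt_add_iff_left 1).2 hη).le.trans hc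
      simp only [erasedBelow, hη'.not_gt, hc.not_gt, if_false]

theorem interp_erase (w : Word.{u} S) :
    interp (Program.erase o) w.1 = Part.some (ordTape o 0) := by
  obtain ⟨X, ξ, hX⟩ := w
  obtain ⟨N, hN⟩ : ∃ N, 1 + N = max 1 ξ := ⟨_, Ordinal.add_sub_cancel_of_le (le_max_left 1 ξ)⟩
  have hstart : step (Program.erase o) ⟨X, EraseState.start.code, 0⟩ =
      ⟨erasedBelow o X (1 + 0), EraseState.erase.code, 1 + 0⟩ := by
    rw [add_zero, erasedBelow_one, ← zero_add 1]
    exact step_write rfl (erase_apply o .start _)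
  have herase := erase_reaches o (X := X) (N := N) fun η hη => (hX _).2 <| by
    have hlt : 1 + η < max 1 ξ := hN ▸ (add_lt_add_iff_left 1).2 hη
    exact (lt_max_iff.1 hlt).resolve_left le_self_add.not_gt
  have hresult : erasedBelow o X (max 1 ξ) = ordTape o 0 := by
    funext c
    have hblank (h : max 1 ξ ≤ c) : X c = none := by
      have := (hX c).not.2 ((le_max_right 1 ξ).trans h).not_gt
      simpa using this
    simp only [erasedBelow, ordTape]
    split_ifs with h0 h
    exacts [rfl, rfl, hblank (not_lt.1 h)]
  rw [hN, hresult] at herase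
  have hhalt : step (Program.erase o) ⟨ordTape o 0, EraseState.erase.code, max 1 ξ⟩ =
      ⟨ordTape o 0, 1, max 1 ξ⟩ :=
    step_keep (by simp [ordTape]) (erase_apply o .erase none)
  have hfirst := (Reaches.refl _ {EraseState.start.code} _).step (mem_singleton _) hstart
  have hne : EraseState.erase.code ∉ ({EraseState.start.code} : Set Ordinal.{u}) :=
    EraseState.code_injective.ne nofun
  have hall := (hfirst.trans herase (disjoint_singleton_right.2 hne) hne).step (.inr rfl) hhalt
  rw [show EraseState.start.code = 0 from stateCode_zero_zero] at hall
  exact hall.interp_eq_some (by simp [(EraseState.code_ne_one _).symm])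

theorem isSemidecidable_univ : IsSemidecidable o (univ : Set (Word.{u} S)) :=
  ⟨Program.erase o, fun w => by
    rw [interp_erase]
    exact Part.eq_some_iff.2 ((Part.mem_map_iff _).2 ⟨singleWord o, ⟨trivial, rfl⟩, rfl⟩)⟩

end Erase

section Main

variable {S : Type v} [Fintype S] [LinearOrder (Option S)] {o : S}

theorem mem_interp_of_semidecides {A : Set (Word.{u} S)} {p : Program.{u} S}
    (hp : ∀ w : Word.{u} S, (pseudoChar o A w).map Subtype.val = interp p w.1) {w : Word.{u} S}
    {y : Tape.{u} S} : y ∈ interp p w.1 ↔ w ∈ A ∧ y = ordTape o 0 := by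
  rw [← hp, Part.mem_map_iff]
  exact ⟨fun ⟨_, ⟨hw, hv⟩, hy⟩ => ⟨hw, by rw [← hy, ← hv]; rfl⟩,
    fun ⟨hw, hy⟩ => ⟨singleWord o, ⟨hw, rfl⟩, hy.symm⟩⟩

/-- If `q` enumerates all words and `p` semidecides a class of words, this program enumerates that
class: on input `2 * β`, it makes a copy of `β`, runs `p` on the word that `q` puts out on input `β`
and, when `p` has halted, runs `q` once more, on the copy. -/
def Program.enumerate (o : S) (p q : Program.{u} S) : Program.{u} S :=
  q.comp ((Program.halve o).comp ((p.comp q).even.comp (.mark o)))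

theorem mem_interp_enumerate_two_mul {p q : Program.{u} S} {β : Ordinal.{u}} {y : Tape.{u} S}
    (hp : ∀ v ∈ interp q (ordTape o β), ∀ z ∈ interp p v, z = ordTape o 0) :
    y ∈ interp (.enumerate o p q) (ordTape o (2 * β)) ↔
      y ∈ interp q (ordTape o β) ∧ (interp p y).Dom := by
  simp only [Program.enumerate, mem_interp_comp, interp_mark_two_mul, interp_even,
    Part.mem_some_iff, Part.mem_map_iff, exists_eq_left]
  constructor
  · rintro ⟨x, ⟨_, ⟨z, ⟨v, hv, hz⟩, rfl⟩, hx⟩, hy⟩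
    obtain rfl := hp v hv z hz
    rw [interp_halve, Part.mem_some_iff] at hx
    obtain rfl := hx
    obtain rfl := Part.mem_unique hv hy
    exact ⟨hv, Part.dom_iff_mem.2 ⟨_, hz⟩⟩
  · rintro ⟨hy, hdom⟩
    obtain ⟨z, hz⟩ := Part.dom_iff_mem.1 hdom
    obtain rfl := hp y hy z hz
    refine ⟨ordTape o β, ⟨_, ⟨_, ⟨y, hy, hz⟩, rfl⟩, ?_⟩, hy⟩
    rw [interp_halve]
    exact Part.mem_some _

theorem notMem_interp_enumerate_two_mul_add_one (p q : Program.{u} S) (β : Ordinal.{u})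
    (y : Tape.{u} S) : y ∉ interp (.enumerate o p q) (ordTape o (2 * β + 1)) := by
  simp [Program.enumerate, mem_interp_comp, interp_mark_two_mul_add_one]

theorem IsSemidecidable.isCE {A : Set (Word.{u} S)} (hA : IsSemidecidable o A)
    (hSC : SymmetryCondition.{u, v} S o) : IsCE o A := by
  obtain ⟨p, hp⟩ := hA
  obtain ⟨q, hq⟩ := hSC
  have hword {v : Tape.{u} S} {β : Ordinal.{u}} (hv : v ∈ interp q (ordTape o β)) :
      ∃ w : Word.{u} S, w.1 = v := by
    obtain ⟨w, -, hw⟩ := hq.ge ⟨β, hv⟩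
    exact ⟨w, hw⟩
  have hvalue (β : Ordinal.{u}) :
      ∀ v ∈ interp q (ordTape o β), ∀ z ∈ interp p v, z = ordTape o 0 := by
    intro v hv z hz
    obtain ⟨w, rfl⟩ := hword hv
    exact ((mem_interp_of_semidecides hp).1 hz).2
  refine ⟨.enumerate o p q, Subset.antisymm ?_ ?_⟩
  · rintro _ ⟨w, hw, rfl⟩
    obtain ⟨β, hβ⟩ : ∃ β, w.1 ∈ interp q (ordTape o β) := hq.le ⟨w, trivial, rfl⟩
    exact ⟨2 * β, (mem_interp_enumerate_two_mul (hvalue β)).2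
      ⟨hβ, Part.dom_iff_mem.2 ⟨_, (mem_interp_of_semidecides hp).2 ⟨hw, rfl⟩⟩⟩⟩
  · rintro y ⟨α, hy⟩
    obtain ⟨β, rfl | rfl⟩ := eq_two_mul_or_eq_two_mul_add_one α
    · obtain ⟨hq, hdom⟩ := (mem_interp_enumerate_two_mul (hvalue β)).1 hy
      obtain ⟨w, rfl⟩ := hword hq
      obtain ⟨z, hz⟩ := Part.dom_iff_mem.1 hdom
      exact ⟨w, ((mem_interp_of_semidecides hp).1 hz).1, rfl⟩
    · exact (notMem_interp_enumerate_two_mul_add_one p q β y hy).elim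

end Main

end SymMachine

end

theorem proposition6p4 {S : Type v} [Fintype S] [LinearOrder (Option S)]
    (zero one : S) (hne : zero ≠ one) :
    SymMachine.SymmetryCondition.{u, v} S zero ↔
      ∀ A : Set (SymMachine.Word.{u, v} S), A.Nonempty →
        SymMachine.IsSemidecidable zero A → SymMachine.IsCE zero A :=
  ⟨fun hSC _ _ hA => SymMachine.IsSemidecidable.isCE hA hSC,
    fun h => h Set.univ ⟨SymMachine.singleWord zero, trivial⟩
      (SymMachine.isSemidecidable_univ zero)⟩
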